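/- Let $M$ be a connected, oriented, smooth (Hausdorff, second countable) manifold of dimension $n\ge 1$ without boundary, with tangent bundle $\pi:TM\to M$. For $h\in C^\infty(M)$ let $\dot h(u)=u\langle h\rangle$ be its scalar lift to $TM$, and let $\mathcal R=\dot x^\mu\,\partial/\partial\dot x^\mu$ be the radial vector field. Let $U\subset TM$ be a conic sub-bundle, that is, an open set of non-zero vectors with $\pi(U)=M$ such that $\lambda u\in U$ for all $u\in U$ and $\lambda\neq0$. A Vlasov field on $U$ is a smooth vector field $W$ on $U$ with $\pi_*(W|_u)=u$ and $W\langle\dot h\rangle|_{\lambda u}=\lambda^2\,W\langle\dot h\rangle|_u$ for all $u\in U$, $\lambda>0$ and $h\in C^\infty(M)$. A Vlasov bivector on $U$ is a bivector field of the form $\Psi=\mathcal R\wedge W$ with $W$ a Vlasov field. Let $\Psi$ be a Vlasov bivector on $U$ and let $\theta$ be a smooth $(2n-2)$-form on $U$ (a particle density form) satisfying the transport equations: $d\theta=0$, and $i_X\theta=i_Y\theta=0$ for all smooth vector fields $X,Y$ on $U$ with $\Psi=X\wedge Y$. Let $\chi$ be a support form on $U$: a smooth $1$-form whose pull-back to every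 ray $\{\lambda u:\lambda>0\}$, $u\in U$, has compact support in the ray and satisfies $\int_0^\infty\chi|_{\lambda u}\big(\tfrac{d}{d\lambda}(\lambda u)\big)\,d\lambda=1$. Assume that $\chi\wedge\theta$ has vertical compact support: for each $p\in M$, its restriction to $U_p=U\cap T_pM$ has compact support in $U_p$. Let $\mathcal J=\pi_\varsigma(\chi\wedge\theta)$ be its integral along the fibres of $U$, an $(n-1)$-form on $M$; in oriented coordinates, $\pi_\varsigma$ sends $f\,dx^I\wedge d\dot x^1\wedge\dots\wedge d\dot x^n$ to $\big(\int_{U_p} f\,d\dot x^1\cdots d\dot x^n\big)dx^I$ and forms of lower degree in the $d\dot x^\mu$ to $0$. Then the current $\mathcal J$ satisfies the continuity equation (charge conservation) $$d\mathcal J=0$$ whenever $\mathcal J$ is a smooth form on $M$; and $\mathcal J$ is always smooth if the support of $\chi\wedge\theta$ in $U$ meets $\pi^{-1}(K)$ in a compact set for every compact $K\subset M$. -/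

import Mathlib

open Set Filter Topology MeasureTheory Bundle
open scoped Manifold ContDiff

noncomputable section

/-! ### Differential forms and vector fields on a manifold -/

section Forms

variable {E H N : Type*} [NormedAddCommGroup E] [NormedSpace ℝ E] [TopologicalSpace H]
  (I : ModelWithCorners ℝ E H) [TopologicalSpace N] [ChartedSpace H N]

/-- A (not necessarily smooth) differential `k`-form on the manifold `N`. A form on an open subset
`U` of `N` is treated as a form on `N` of which only the values at the points of `U` are used. -/
abbrev DiffForm (N : Type*) [TopologicalSpace N] [ChartedSpace H N] (k : ℕ) : Type _ :=
  ∀ x : N, TangentSpace I x [⋀^Fin k]→L[ℝ] ℝ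

variable {I}

/-- The expression of the form `α` in the chart around `x₀`: the pull-back of `α` by the inverse of
the chart, a form on the model vector space. -/
def DiffForm.inChart {k : ℕ} (α : DiffForm I N k) (x₀ : N) (y : E) : E [⋀^Fin k]→L[ℝ] ℝ :=
  (α ((extChartAt I x₀).symm y)).compContinuousLinearMap
    (mfderiv 𝓘(ℝ, E) I (extChartAt I x₀).symm y)

/-- The form `α` is smooth on the open set `s`. -/
def DiffForm.SmoothOn {k : ℕ} (α : DiffForm I N k) (s : Set N) : Prop :=
  ∀ x ∈ s, ContDiffAt ℝ ∞ (α.inChart x) (extChartAt I x x)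

/-- The exterior derivative of a form on a manifold without boundary, computed in the chart around
each point. -/
def DiffForm.d {k : ℕ} (α : DiffForm I N k) : DiffForm I N (k + 1) := fun x =>
  (extDeriv (α.inChart x) (extChartAt I x x)).compContinuousLinearMap
    (mfderiv I 𝓘(ℝ, E) (extChartAt I x) x)

/-- The wedge product `χ ∧ θ` of a `1`-form and a `k`-form:
`(χ ∧ θ)(v₀, …, v_k) = ∑ i, (-1) ^ i * χ(v_i) * θ(v₀, …, v_{i-1}, v_{i+1}, …, v_k)`. -/
def DiffForm.wedgeOne {k : ℕ} (χ : DiffForm I N 1) (θ : DiffForm I N k) : DiffForm I N (k + 1) :=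
  fun x => ContinuousAlternatingMap.alternatizeUncurryFin (E := E) (F := ℝ)
    (((ContinuousAlternatingMap.ofSubsingleton ℝ E ℝ (0 : Fin 1)).symm (χ x)).smulRight (θ x))

/-- The interior contraction `i_X α` vanishes on `s`: at every point of `s`, the form `α` vanishes
as soon as one of its arguments is `X`. (For a `0`-form this always holds.) -/
def DiffForm.ContractionVanishesOn {k : ℕ} (X : ∀ x : N, TangentSpace I x) (α : DiffForm I N k)
    (s : Set N) : Prop :=
  ∀ x ∈ s, ∀ v : Fin k → TangentSpace I x, (∃ i, v i = X x) → α x v = 0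

variable (I) in
/-- The vector field `X` is smooth on the open set `s`. -/
def SmoothVectorFieldOn [IsManifold I 1 N] (X : ∀ x : N, TangentSpace I x) (s : Set N) : Prop :=
  ContMDiffOn I I.tangent ∞ (fun x => (⟨x, X x⟩ : TangentBundle I N)) s

/-- The derivative `X⟨h⟩` of a scalar field `h` along a vector field `X`. -/
def vectorDeriv (X : ∀ x : N, TangentSpace I x) (h : N → ℝ) (x : N) : ℝ :=
  mfderiv I 𝓘(ℝ, ℝ) h x (X x)

variable (I) in
/-- A bivector field on `N`. -/
abbrev BivectorField (N : Type*) [TopologicalSpace N] [ChartedSpace H N] : Type _ :=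
  ∀ x : N, ⋀[ℝ]^2 (TangentSpace I x)

/-- The simple bivector field `X ∧ Y`. -/
def simpleBivector (X Y : ∀ x : N, TangentSpace I x) : BivectorField I N :=
  fun x => exteriorPower.ιMulti ℝ 2 ![X x, Y x]

/-- The null condition `Null(Φ, α)` on the open set `s`: for all smooth vector fields `X`, `Y` on `s`
with `Φ = X ∧ Y` on `s`, both `i_X α = 0` and `i_Y α = 0` on `s`. -/
def NullConditionOn [IsManifold I 1 N] {k : ℕ} (Φ : BivectorField I N) (α : DiffForm I N k)
    (s : Set N) : Prop :=
  ∀ X Y : ∀ x : N, TangentSpace I x, SmoothVectorFieldOn I X s → SmoothVectorFieldOn I Y s →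
    (∀ x ∈ s, Φ x = simpleBivector X Y x) →
      α.ContractionVanishesOn X s ∧ α.ContractionVanishesOn Y s

end Forms

/-! ### Conic sub-bundles of the tangent bundle, Vlasov fields and Vlasov bivectors -/

section Vlasov

variable {n : ℕ} {M : Type*} [TopologicalSpace M] [ChartedSpace (EuclideanSpace ℝ (Fin n)) M]
  [IsManifold (𝓡 n) ∞ M]

/-- A conic sub-bundle: an open subset of the slit tangent bundle, with non-empty fibres, invariant
under multiplication by non-zero scalars. -/
structure IsConicSubbundle (U : Set (TangentBundle (𝓡 n) M)) : Prop where
  isOpen : IsOpen U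
  ne_zero : ∀ u ∈ U, u.2 ≠ 0
  proj_image : (fun u : TangentBundle (𝓡 n) M => u.proj) '' U = univ
  smul_mem : ∀ u ∈ U, ∀ c : ℝ, c ≠ 0 → (⟨u.proj, c • u.2⟩ : TangentBundle (𝓡 n) M) ∈ U

/-- The inclusion `y ↦ (p, y)` of the fibre `T_p M` in `TM`. -/
def fibreIncl (p : M) (y : EuclideanSpace ℝ (Fin n)) : TangentBundle (𝓡 n) M := ⟨p, y⟩

/-- The vertical lift of `e ∈ T_p M` to `T_u TM`, where `p = π u`: the velocity of the curve
`t ↦ u + t e` in the fibre. -/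
def verticalLift (u : TangentBundle (𝓡 n) M) (e : EuclideanSpace ℝ (Fin n)) :
    TangentSpace (𝓡 n).tangent u :=
  mfderiv 𝓘(ℝ, EuclideanSpace ℝ (Fin n)) (𝓡 n).tangent (fibreIncl (M := M) u.proj) u.2 e

/-- The radial vector field `ẋ^μ ∂/∂ẋ^μ`. -/
def radialField (u : TangentBundle (𝓡 n) M) : TangentSpace (𝓡 n).tangent u :=
  verticalLift u u.2

/-- The scalar lift `ḣ(u) = u⟨h⟩` of a scalar field `h`. -/
def scalarLift (h : M → ℝ) (u : TangentBundle (𝓡 n) M) : ℝ :=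
  mfderiv (𝓡 n) 𝓘(ℝ, ℝ) h u.proj u.2

/-- A Vlasov field on `U`: a smooth vector field on `U` which is horizontal, `π_* (W u) = u`, and
radially quadratic. -/
structure IsVlasovField (U : Set (TangentBundle (𝓡 n) M))
    (W : ∀ u : TangentBundle (𝓡 n) M, TangentSpace (𝓡 n).tangent u) : Prop where
  smooth : SmoothVectorFieldOn (𝓡 n).tangent W U
  horizontal : ∀ u ∈ U,
    mfderiv (𝓡 n).tangent (𝓡 n) (fun w : TangentBundle (𝓡 n) M => w.proj) u (W u) = u.2
  radially_quadratic : ∀ h : M → ℝ, ContMDiff (𝓡 n) 𝓘(ℝ, ℝ) ∞ h → ∀ u ∈ U, ∀ c : ℝ, 0 < c →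
    vectorDeriv W (scalarLift h) ⟨u.proj, c • u.2⟩ = c ^ 2 * vectorDeriv W (scalarLift h) u

/-- A Vlasov bivector on `U`: a bivector field of the form `ℛ ∧ W` with `ℛ` the radial field and `W`
a Vlasov field. -/
def IsVlasovBivector (U : Set (TangentBundle (𝓡 n) M))
    (Ψ : BivectorField (𝓡 n).tangent (TangentBundle (𝓡 n) M)) : Prop :=
  ∃ W : ∀ u : TangentBundle (𝓡 n) M, TangentSpace (𝓡 n).tangent u,
    IsVlasovField U W ∧ ∀ u ∈ U, Ψ u = simpleBivector radialField W u

/-- A particle density form on `U`: a smooth `(2n-2)`-form satisfying the transport equations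
`Null(Ψ, θ)` and `dθ = 0`. -/
structure TransportEquations (U : Set (TangentBundle (𝓡 n) M))
    (Ψ : BivectorField (𝓡 n).tangent (TangentBundle (𝓡 n) M))
    (θ : DiffForm (𝓡 n).tangent (TangentBundle (𝓡 n) M) (2 * n - 2)) : Prop where
  smooth : θ.SmoothOn U
  null : NullConditionOn Ψ θ U
  closed : ∀ u ∈ U, θ.d u = 0

/-- The coefficient of the pull-back of the `1`-form `χ` to the ray `{c u : c > 0}`: this pull-back
is `rayCoefficient χ u c dc`. -/
def rayCoefficient (χ : DiffForm (𝓡 n).tangent (TangentBundle (𝓡 n) M) 1)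
    (u : TangentBundle (𝓡 n) M) (c : ℝ) : ℝ :=
  χ (fibreIncl u.proj (c • u.2)) (fun _ => verticalLift (fibreIncl u.proj (c • u.2)) u.2)

/-- A support form on `U`: a smooth `1`-form on `U` whose pull-back to each ray `{c u : c > 0}` in
`U` has compact support in the ray and integral `1`. -/
structure IsSupportForm (U : Set (TangentBundle (𝓡 n) M))
    (χ : DiffForm (𝓡 n).tangent (TangentBundle (𝓡 n) M) 1) : Prop where
  smooth : χ.SmoothOn U
  compact_support : ∀ u ∈ U, ∃ K ⊆ Ioi (0 : ℝ), IsCompact K ∧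
    ∀ c : ℝ, 0 < c → c ∉ K → rayCoefficient χ u c = 0
  integral_eq_one : ∀ u ∈ U, ∫ c in Ioi (0 : ℝ), rayCoefficient χ u c = 1

end Vlasov

/-! ### Integration along the fibre -/

section Fibre

variable {n : ℕ} {M : Type*} [TopologicalSpace M] [ChartedSpace (EuclideanSpace ℝ (Fin n)) M]
  [IsManifold (𝓡 n) ∞ M]

variable (n M) in
/-- An orientation of the manifold `M`, that is, of the vector bundle `TM`: an orientation of each
tangent space, locally constant in the local trivialisations of `TM`. -/
structure ManifoldOrientation where
  orient : ∀ p : M, Orientation ℝ (TangentSpace (𝓡 n) p) (Fin n)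
  locally_constant : ∀ p : M,
    ∃ w : Orientation ℝ (EuclideanSpace ℝ (Fin n)) (Fin n), ∀ᶠ q in 𝓝 p,
      ∀ hq : q ∈ (trivializationAt (EuclideanSpace ℝ (Fin n)) (TangentSpace (𝓡 n)) p).baseSet,
        Orientation.map (Fin n)
          ((trivializationAt (EuclideanSpace ℝ (Fin n)) (TangentSpace (𝓡 n)) p).linearEquivAt
            ℝ q hq) (orient q) = w

open Classical in
/-- The sign of the standard basis of the model space `EuclideanSpace ℝ (Fin n)` of `T_p M` with
respect to the given orientation. -/
def ManifoldOrientation.sign (o : ManifoldOrientation n M) (p : M) : ℝ :=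
  if o.orient p = (EuclideanSpace.basisFun (Fin n) ℝ).toBasis.orientation then 1 else -1

/-- A linear lift of `T_p M` to `T_u TM`, where `p = π u`: the differential at `p` of a smooth local
section of `TM` through `u`. -/
def sectionLift (u : TangentBundle (𝓡 n) M) :
    TangentSpace (𝓡 n) u.proj →L[ℝ] TangentSpace (𝓡 n).tangent u :=
  mfderiv (𝓡 n) (𝓡 n).tangent
    (fun q => (⟨q, FiberBundle.extend (EuclideanSpace ℝ (Fin n)) u.2 q⟩ : TangentBundle (𝓡 n) M))
    u.proj

/-- `sectionLift` is a lift. -/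
theorem mfderiv_proj_sectionLift (u : TangentBundle (𝓡 n) M) (v : TangentSpace (𝓡 n) u.proj) :
    mfderiv (𝓡 n).tangent (𝓡 n) (fun w : TangentBundle (𝓡 n) M => w.proj) u (sectionLift u v) = v := by
  have h1 : MDifferentiableAt (𝓡 n).tangent (𝓡 n) (fun w : TangentBundle (𝓡 n) M => w.proj) u :=
    (contMDiffAt_proj (n := 1) (TangentSpace (𝓡 n))).mdifferentiableAt one_ne_zero
  have h2 := FiberBundle.mdifferentiableAt_extend (𝓡 n) (EuclideanSpace ℝ (Fin n)) u.2
  have h3 : (⟨u.proj, FiberBundle.extend (EuclideanSpace ℝ (Fin n)) u.2 u.proj⟩ :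
      TangentBundle (𝓡 n) M) = u := by simp
  have h4 := (h3.symm ▸ h1.hasMFDerivAt :
    HasMFDerivAt (𝓡 n).tangent (𝓡 n) (fun w : TangentBundle (𝓡 n) M => w.proj)
      (⟨u.proj, FiberBundle.extend (EuclideanSpace ℝ (Fin n)) u.2 u.proj⟩ : TangentBundle (𝓡 n) M)
      (mfderiv (𝓡 n).tangent (𝓡 n) (fun w : TangentBundle (𝓡 n) M => w.proj) u))
  have h5 := h4.comp u.proj h2.hasMFDerivAt
  have h6 := hasMFDerivAt_unique h5 (hasMFDerivAt_id u.proj)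
  exact congrArg (fun f => f v) h6

theorem append_update_cast {E V : Type*} {q k m : ℕ} (hq : q = k + m) (L : E → V) (e : Fin m → V)
    [DecidableEq (Fin k)] [DecidableEq (Fin q)] (v : Fin k → E) (i : Fin k) (z : E) :
    (fun l => Fin.append (fun j => L (Function.update v i z j)) e (Fin.cast hq l)) =
      Function.update (fun l => Fin.append (fun j => L (v j)) e (Fin.cast hq l))
        (Fin.cast hq.symm (Fin.castAdd m i)) (L z) := by
  subst hq
  funext l
  refine Fin.addCases (fun j => ?_) (fun j => ?_) l
  · by_cases hj : j = i <;> simp [Function.update_apply, hj]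
  · have h : Fin.natAdd k j ≠ Fin.castAdd m i := by
      intro h
      have := congrArg Fin.val h
      simp only [Fin.val_natAdd, Fin.val_castAdd] at this
      omega
    simp [Function.update_apply, h]

/-- For an alternating map `A` of degree `q = k + m`, a linear map `L` and vectors `e₁, …, e_m`, the
alternating map `(v₁, …, v_k) ↦ A(L v₁, …, L v_k, e₁, …, e_m)`. -/
def contractLast {E V : Type*} [NormedAddCommGroup E] [NormedSpace ℝ E] [AddCommGroup V]
    [TopologicalSpace V] [Module ℝ V] {q k m : ℕ} (hq : q = k + m)
    (A : V [⋀^Fin q]→L[ℝ] ℝ) (L : E →L[ℝ] V) (e : Fin m → V) : E [⋀^Fin k]→L[ℝ] ℝ where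
  toFun v := A (fun i => Fin.append (fun j => L (v j)) e (Fin.cast hq i))
  map_update_add' := by
    intro _ v i x y
    simp only [append_update_cast hq L e v i, map_add, ContinuousAlternatingMap.map_update_add]
  map_update_smul' := by
    intro _ v i c x
    simp only [append_update_cast hq L e v i, map_smul, ContinuousAlternatingMap.map_update_smul]
  map_eq_zero_of_eq' := by
    intro v i j hv hij
    exact A.map_eq_zero_of_eq _ (i := Fin.cast hq.symm (Fin.castAdd m i))
      (j := Fin.cast hq.symm (Fin.castAdd m j)) (by simp [hv])
      (by simpa [Fin.ext_iff] using hij)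
  cont := by
    refine A.cont.comp (continuous_pi fun i => ?_)
    subst hq
    refine Fin.addCases (fun j => ?_) (fun j => ?_) i
    · simpa using L.continuous.comp' (continuous_apply j)
    · simpa using continuous_const

/-- The restriction of `α` to each fibre `U ∩ T_p M` of `U` has compact support in that fibre. -/
def HasVerticalCompactSupport (U : Set (TangentBundle (𝓡 n) M)) {q : ℕ}
    (α : DiffForm (𝓡 n).tangent (TangentBundle (𝓡 n) M) q) : Prop :=
  ∀ p : M, ∃ K : Set (EuclideanSpace ℝ (Fin n)), IsCompact K ∧ (∀ y ∈ K, fibreIncl p y ∈ U) ∧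
    ∀ y, fibreIncl p y ∈ U → y ∉ K → α (fibreIncl p y) = 0

/-- The support of `α` in `U` has compact intersection with `π ⁻¹ (K)` for each compact `K ⊆ M`. -/
def HasProperVerticalSupport (U : Set (TangentBundle (𝓡 n) M)) {q : ℕ}
    (α : DiffForm (𝓡 n).tangent (TangentBundle (𝓡 n) M) q) : Prop :=
  ∀ K : Set M, IsCompact K → ∃ C ⊆ U, IsCompact C ∧ ∀ u ∈ U, u.proj ∈ K → u ∉ C → α u = 0

/-- The integral along the fibre `π_ς α` of a form `α` of degree `q = k + n` on `U`, a `k`-form on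
`M`: at `p`, the arguments `v₁, …, v_k ∈ T_p M` are lifted to `U`, the last `n` slots of `α` are filled
with the vertical lifts of the standard basis of the model space of `T_p M`, and the result is
integrated over the fibre `U ∩ T_p M`, oriented by the orientation of `T_p M`. The value does not
depend on the lifts, since `n + 1` vertical vectors are linearly dependent. In coordinates,
`π_ς (f dx^I ∧ dẋ¹ ∧ ⋯ ∧ dẋⁿ) = (∫ f dẋ¹ ⋯ dẋⁿ) dx^I`, so that
`∫_U π^* β ∧ α = ∫_M β ∧ π_ς α` for every form `β` of compact support. -/
def fibreIntegral (o : ManifoldOrientation n M) (U : Set (TangentBundle (𝓡 n) M)) {q k : ℕ}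
    (hq : q = k + n) (α : DiffForm (𝓡 n).tangent (TangentBundle (𝓡 n) M) q) :
    DiffForm (𝓡 n) M k := fun p =>
  o.sign p • ∫ y in {y : EuclideanSpace ℝ (Fin n) | fibreIncl p y ∈ U},
    contractLast hq (E := EuclideanSpace ℝ (Fin n)) (α (fibreIncl p y))
      (sectionLift (fibreIncl p y))
      (fun i => verticalLift (fibreIncl p y) (EuclideanSpace.basisFun (Fin n) ℝ i))

/-- The current `𝒥 = π_ς (χ ∧ θ)`, an `(n-1)`-form on `M`. -/
def current (hn : 1 ≤ n) (o : ManifoldOrientation n M) (U : Set (TangentBundle (𝓡 n) M))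
    (χ : DiffForm (𝓡 n).tangent (TangentBundle (𝓡 n) M) 1)
    (θ : DiffForm (𝓡 n).tangent (TangentBundle (𝓡 n) M) (2 * n - 2)) :
    DiffForm (𝓡 n) M (n - 1) :=
  fibreIntegral o U (by omega) (χ.wedgeOne θ)

end Fibre

end

noncomputable section

set_option linter.unusedSectionVars false

/-! ### Integrals depending on a parameter -/

section ParametricIntegral

variable {P G E' : Type*} [NormedAddCommGroup P] [NormedSpace ℝ P] [NormedAddCommGroup G]
  [NormedSpace ℝ G] [MeasurableSpace G] [BorelSpace G] [NormedAddCommGroup E'] [NormedSpace ℝ E']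
  {μ : Measure G}

/-! Write α = χ ∧ θ. In a chart of TM the current is, up to a locally constant sign, the fibre
integral of α, and fibre integration commutes with d. So dJ is the fibre integral of the top-degree
form dα, and it suffices that dα integrates to zero along every ray.

Let φ_t(x, y) = (x, e^t y) be the flow of the radial field ℛ. With r = e^t, the integral along the
ray through z, in polar coordinates, is a value at z of the top-degree form Ω = ∫ φ_t^* dα dt. A
top-degree form annihilated by a non-zero vector is zero (`eq_zero_of_top_degree`), so only i_ℛ Ω =
0 is needed. By Cartan's formula (`extDeriv_radialFlow`), φ_t^*(i_ℛ dα) = d/dt φ_t^*α − d(φ_t^* i_ℛ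
α). The first term integrates to zero, since α is compactly supported along the orbit. For the
second, i_ℛ θ = 0 gives i_ℛ α = χ(ℛ) θ (`wedgeOneForm_cons`), and together with dθ = 0 it makes θ
invariant under φ_t (`radialFlow_invariant`). Hence ∫ φ_t^* i_ℛ α dt = (∫ χ(ℛ) ∘ φ_t dt) θ = θ by
the normalisation of χ, and dθ = 0. This is `integral_extDeriv_radialFlow_eq_zero`.

Differentiating under the integral needs the support of α to be compact locally uniformly in the
base point. Proper support gives this everywhere, hence smoothness of J. Vertical compact support
gives it only on a dense set of base points, by Baire
(`HasVerticalCompactSupport.dense_exists_compact`); when J is smooth, dJ is continuous, so its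
vanishing on that set extends to all points. -/

theorem convolution_one_zero_eq_integral [μ.IsNegInvariant] (g : G → E') :
    convolution (fun _ : G => (1 : ℝ)) g (ContinuousLinearMap.lsmul ℝ ℝ) μ 0 = ∫ y, g y ∂μ := by
  simp only [convolution, zero_sub, ContinuousLinearMap.lsmul_apply, one_smul]
  exact integral_neg_eq_self g μ

/-- An integral with a parameter is the convolution of the integrand with the constant 1, evaluated
at 0; smoothness of convolutions depending on a parameter therefore applies. -/
theorem contDiffOn_integral_of_compactSupport [μ.IsNegInvariant] [IsLocallyFiniteMeasure μ] {r : ℕ∞}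
    {g : P → G → E'} {s : Set P} {k : Set G} (hs : IsOpen s) (hk : IsCompact k)
    (hgs : ∀ p, ∀ x, p ∈ s → x ∉ k → g p x = 0)
    (hg : ContDiffOn ℝ r (Function.uncurry g) (s ×ˢ univ)) :
    ContDiffOn ℝ r (fun p => ∫ y, g p y ∂μ) s := by
  have h := contDiffOn_convolution_right_with_param_comp (μ := μ) (f := fun _ : G => (1 : ℝ))
    (ContinuousLinearMap.lsmul ℝ ℝ : ℝ →L[ℝ] E' →L[ℝ] E') (v := fun _ : P => (0 : G))
    contDiffOn_const hs hk hgs (locallyIntegrable_const 1) hg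
  simpa only [convolution_one_zero_eq_integral] using h

theorem integrable_of_compactSupport [SecondCountableTopology G] [IsLocallyFiniteMeasure μ]
    {g : G → E'} {k : Set G} (hk : IsCompact k) (hgk : ∀ x, x ∉ k → g x = 0) (hg : Continuous g) :
    Integrable g μ :=
  hg.integrable_of_hasCompactSupport (HasCompactSupport.intro hk hgk)

theorem continuous_fderiv_prodMk {g : P → G → E'} {s : Set P} (hs : IsOpen s)
    (hg : ContDiffOn ℝ 1 (Function.uncurry g) (s ×ˢ univ)) {p : P} (hp : p ∈ s) :
    Continuous fun y => fderiv ℝ (Function.uncurry g) (p, y) := by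
  have h : ContinuousOn (fderiv ℝ (Function.uncurry g)) (s ×ˢ univ) :=
    hg.continuousOn_fderiv_of_isOpen (hs.prod isOpen_univ) le_rfl
  exact h.comp_continuous (by fun_prop) fun y => ⟨hp, mem_univ _⟩

theorem fderiv_eq_zero_of_notMem_compact {g : P → G → E'} {s : Set P} {k : Set G} (hs : IsOpen s)
    (hk : IsCompact k) (hgs : ∀ p, ∀ x, p ∈ s → x ∉ k → g p x = 0) {p : P} (hp : p ∈ s) {y : G}
    (hy : y ∉ k) : fderiv ℝ (Function.uncurry g) (p, y) = 0 := by
  refine (hasFDerivAt_zero_of_eventually_const 0 ?_).fderiv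
  filter_upwards [(hs.prod hk.isClosed.isOpen_compl).mem_nhds
    (show (p, y) ∈ s ×ˢ kᶜ from ⟨hp, hy⟩)] with q hq
  exact hgs q.1 q.2 hq.1 hq.2

theorem fderiv_integral_of_compactSupport [μ.IsNegInvariant] [IsLocallyFiniteMeasure μ]
    [SecondCountableTopology G] [CompleteSpace E'] {g : P → G → E'} {s : Set P} {k : Set G}
    (hs : IsOpen s) (hk : IsCompact k)
    (hgs : ∀ p, ∀ x, p ∈ s → x ∉ k → g p x = 0)
    (hg : ContDiffOn ℝ 1 (Function.uncurry g) (s ×ˢ univ)) {p : P} (hp : p ∈ s) (v : P) :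
    fderiv ℝ (fun p => ∫ y, g p y ∂μ) p v =
      ∫ y, fderiv ℝ (Function.uncurry g) (p, y) (v, 0) ∂μ := by
  -- The convolution is differentiated jointly in the parameter and the translation, then restricted
  -- to translation 0.
  have h := hasFDerivAt_convolution_right_with_param (μ := μ) (f := fun _ : G => (1 : ℝ))
    (ContinuousLinearMap.lsmul ℝ ℝ : ℝ →L[ℝ] E' →L[ℝ] E') hs hk hgs (locallyIntegrable_const 1)
    hg (p, 0) hp
  have h2 := h.comp (f := fun p : P => (p, (0 : G))) p
    ((hasFDerivAt_id p).prodMk (hasFDerivAt_const (0 : G) p))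
  have h3 : (fun q : P × G => convolution (fun _ : G => (1 : ℝ)) (g q.1)
      (ContinuousLinearMap.lsmul ℝ ℝ) μ q.2) ∘ (fun p : P => (p, (0 : G))) =
      fun p => ∫ y, g p y ∂μ := by
    funext q
    simp [convolution_one_zero_eq_integral]
  rw [h3] at h2
  have hI : Integrable (fun y => fderiv ℝ (Function.uncurry g) (p, y)) μ :=
    integrable_of_compactSupport hk
      (fun y hy => fderiv_eq_zero_of_notMem_compact hs hk hgs hp hy)
      (continuous_fderiv_prodMk hs hg hp)
  have h4 : convolution (fun _ : G => (1 : ℝ)) (fun x => fderiv ℝ (Function.uncurry g) (p, x))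
      (ContinuousLinearMap.precompR (P × G) (ContinuousLinearMap.lsmul ℝ ℝ)) μ 0 =
      ∫ y, fderiv ℝ (Function.uncurry g) (p, y) ∂μ := by
    have : ∀ t : (P × G) →L[ℝ] E', ((ContinuousLinearMap.precompR (P × G)
      (ContinuousLinearMap.lsmul ℝ ℝ : ℝ →L[ℝ] E' →L[ℝ] E')) 1) t = t := by
      intro t; ext <;> simp [ContinuousLinearMap.precompR]
    simp only [convolution, zero_sub, this]
    exact integral_neg_eq_self (fun y => fderiv ℝ (Function.uncurry g) (p, y)) μ
  have h5 : convolution (fun _ : G => (1 : ℝ)) (fun x => fderiv ℝ (Function.HasUncurry.uncurry g)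
      ((p, (0 : G)).1, x)) (ContinuousLinearMap.precompR (P × G) (ContinuousLinearMap.lsmul ℝ ℝ)) μ
      (p, (0 : G)).2 = ∫ y, fderiv ℝ (Function.uncurry g) (p, y) ∂μ := h4
  rw [h2.fderiv, h5, ContinuousLinearMap.comp_apply, ContinuousLinearMap.integral_apply hI]
  rfl

theorem integral_fderiv_eq_zero_of_compactSupport [FiniteDimensional ℝ G] [μ.IsAddHaarMeasure]
    {f : G → E'} {k : Set G} (hk : IsCompact k) (hfk : ∀ x, x ∉ k → f x = 0)
    (hf : ContDiff ℝ 1 f) (v : G) : ∫ y, fderiv ℝ f y v ∂μ = 0 := by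
  have hs : SecondCountableTopology G := inferInstance
  have h1 : Integrable f μ := integrable_of_compactSupport hk hfk hf.continuous
  have h2 : Integrable (fun y => fderiv ℝ f y v) μ := by
    refine integrable_of_compactSupport hk (fun y hy => ?_)
      ((hf.continuous_fderiv one_ne_zero).clm_apply continuous_const)
    have : fderiv ℝ f y = 0 := by
      refine (hasFDerivAt_zero_of_eventually_const 0 ?_).fderiv
      filter_upwards [hk.isClosed.isOpen_compl.mem_nhds hy] with q hq using hfk q hq
    simp [this]
  -- Integration by parts against the constant 1.
  have h := integral_smul_fderiv_eq_neg_fderiv_smul_of_integrable (μ := μ) (𝕜 := ℝ)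
    (f := fun _ : G => (1 : ℝ)) (g := f) (v := v) (by simp) (by simpa using h2)
    (by simpa using h1) (fun _ _ => differentiableAt_const _)
    (fun y _ => hf.differentiable one_ne_zero y)
  simpa using h

end ParametricIntegral

/-! ### Polar coordinates -/

/-- The Haar measure off the origin is the product of a sphere measure and r^(d-1) dr, so Fubini
reduces the integral to rays. -/
theorem integral_eq_zero_of_integral_ray_eq_zero {G : Type*} [NormedAddCommGroup G]
    [NormedSpace ℝ G] [FiniteDimensional ℝ G] [Nontrivial G] [MeasurableSpace G] [BorelSpace G]
    (μ : Measure G) [μ.IsAddHaarMeasure] {f : G → ℝ}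
    (hf : ∀ y, y ≠ 0 → ∫ r in Ioi (0 : ℝ), r ^ (Module.finrank ℝ G - 1) * f (r • y) = 0) :
    ∫ y, f y ∂μ = 0 := by
  have h1 : ∫ y, f y ∂μ = ∫ y : ({(0)}ᶜ : Set G), f y ∂(μ.comap (↑)) := by
    rw [integral_subtype_comap (measurableSet_singleton _).compl f, restrict_compl_singleton]
  have h2 : ∫ y : ({(0)}ᶜ : Set G), f y ∂(μ.comap (↑)) =
      ∫ x : Metric.sphere (0 : G) 1 × Ioi (0 : ℝ), f (x.2.1 • x.1.1)
        ∂μ.toSphere.prod (.volumeIoiPow (Module.finrank ℝ G - 1)) := by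
    rw [← μ.measurePreserving_homeomorphUnitSphereProd.integral_comp
      (Homeomorph.measurableEmbedding _)]
    refine integral_congr_ae (Eventually.of_forall fun y => ?_)
    have := congrArg Subtype.val ((homeomorphUnitSphereProd G).symm_apply_apply y)
    simp only [homeomorphUnitSphereProd_symm_apply_coe] at this
    simp only [this]
  rw [h1, h2]
  -- Fubini needs integrability; without it the Bochner integral is 0 by convention, so no
  -- integrability hypothesis is required.
  by_cases hI : Integrable (fun x : Metric.sphere (0 : G) 1 × Ioi (0 : ℝ) => f (x.2.1 • x.1.1))
      (μ.toSphere.prod (.volumeIoiPow (Module.finrank ℝ G - 1)))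
  · rw [integral_prod _ hI]
    refine integral_eq_zero_of_ae (Eventually.of_forall fun y => ?_)
    have hy : (y : G) ≠ 0 := by
      intro h
      have := y.2
      simp [h] at this
    refine Eq.trans ?_ (hf y hy)
    simp only [Measure.volumeIoiPow, ENNReal.ofReal]
    rw [integral_withDensity_eq_integral_smul,
        integral_subtype_comap measurableSet_Ioi
          fun a ↦ Real.toNNReal (a ^ (Module.finrank ℝ G - 1)) • f (a • (y : G)),
        setIntegral_congr_fun measurableSet_Ioi fun x hx ↦ ?_]
    · rw [NNReal.smul_def, Real.coe_toNNReal _ (pow_nonneg hx.out.le _), smul_eq_mul]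
    · exact (measurable_subtype_coe.pow_const _).real_toNNReal
  · exact integral_undef hI

/-- The substitution r = e^t turns a ray into an orbit of the radial flow, parametrised by time. -/
theorem integral_Ioi_zero_eq_integral_exp {F : Type*} [NormedAddCommGroup F] [NormedSpace ℝ F]
    (h : ℝ → F) : ∫ r in Ioi (0 : ℝ), h r = ∫ t : ℝ, Real.exp t • h (Real.exp t) := by
  have := integral_image_eq_integral_abs_deriv_smul (f := Real.exp) (f' := Real.exp) (s := univ)
    MeasurableSet.univ (fun x _ => (Real.hasDerivAt_exp x).hasDerivWithinAt)
    Real.exp_injective.injOn h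
  rw [image_univ, Real.range_exp] at this
  simpa [abs_of_pos (Real.exp_pos _)] using this

/-! ### Alternating maps -/

section Alternating

open ContinuousAlternatingMap

variable {V V' W : Type*} [NormedAddCommGroup V] [NormedSpace ℝ V] [NormedAddCommGroup V']
  [NormedSpace ℝ V'] [NormedAddCommGroup W] [NormedSpace ℝ W]

theorem finiteDimensional_continuousAlternatingMap [FiniteDimensional ℝ V] (k : ℕ) :
    FiniteDimensional ℝ (V [⋀^Fin k]→L[ℝ] ℝ) := by
  let b := Module.finBasis ℝ V
  let ev : (V [⋀^Fin k]→L[ℝ] ℝ) →ₗ[ℝ] ((Fin k → Fin (Module.finrank ℝ V)) → ℝ) :=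
    { toFun := fun f s => f fun i => b (s i)
      map_add' := fun f g => by ext s; simp
      map_smul' := fun c f => by ext s; simp }
  refine Module.Finite.of_injective ev fun f g h => ?_
  apply ContinuousAlternatingMap.toAlternatingMap_injective
  exact Module.Basis.ext_alternating b fun s _ => congrFun h s

/-- Evaluation on tuples of basis vectors is an injective linear map into a finite product, and its
linear left inverse is continuous in finite dimension. Smoothness can thus be tested on values. -/
theorem contDiffAt_continuousAlternatingMap [FiniteDimensional ℝ V] {k : ℕ} {r : WithTop ℕ∞}
    {f : W → V [⋀^Fin k]→L[ℝ] ℝ} {x : W} (hf : ∀ v, ContDiffAt ℝ r (fun y => f y v) x) :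
    ContDiffAt ℝ r f x := by
  have := finiteDimensional_continuousAlternatingMap (V := V) k
  let b := Module.finBasis ℝ V
  let ev : (V [⋀^Fin k]→L[ℝ] ℝ) →ₗ[ℝ] ((Fin k → Fin (Module.finrank ℝ V)) → ℝ) :=
    { toFun := fun f s => f fun i => b (s i)
      map_add' := fun f g => by ext s; simp
      map_smul' := fun c f => by ext s; simp }
  have hinj : LinearMap.ker ev = ⊥ := by
    refine LinearMap.ker_eq_bot.2 fun f g h => ?_
    apply ContinuousAlternatingMap.toAlternatingMap_injective
    exact Module.Basis.ext_alternating b fun s _ => congrFun h s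
  obtain ⟨p, hp⟩ := ev.exists_leftInverse_of_injective hinj
  have h1 : ContDiffAt ℝ r (fun y => ev (f y)) x := contDiffAt_pi.2 fun s => hf _
  have h2 : f = fun y => p.toContinuousLinearMap (ev (f y)) := by
    funext y
    exact (LinearMap.congr_fun hp (f y)).symm
  rw [h2]
  exact p.toContinuousLinearMap.contDiff.contDiffAt.comp x h1

theorem ContDiffAt.continuousAlternatingMap_apply_const {k : ℕ} {r : WithTop ℕ∞}
    {f : W → V [⋀^Fin k]→L[ℝ] ℝ} {x : W} (hf : ContDiffAt ℝ r f x) (v : Fin k → V) :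
    ContDiffAt ℝ r (fun y => f y v) x :=
  (ContinuousAlternatingMap.apply ℝ V ℝ v).contDiff.contDiffAt.comp x hf

theorem ContDiffAt.continuousAlternatingMap_compContinuousLinearMap [FiniteDimensional ℝ V] {k : ℕ}
    {r : WithTop ℕ∞} {f : W → V' [⋀^Fin k]→L[ℝ] ℝ} {g : W → V →L[ℝ] V'} {x : W}
    (hf : ContDiffAt ℝ r f x) (hg : ContDiffAt ℝ r g x) :
    ContDiffAt ℝ r (fun y => (f y).compContinuousLinearMap (g y)) x := by
  refine contDiffAt_continuousAlternatingMap fun v => ?_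
  have h1 : ContDiffAt ℝ r (fun y =>
      ContinuousMultilinearMap.compContinuousLinearMapContinuousMultilinear ℝ (fun _ : Fin k => V) (fun _ : Fin k => V') ℝ (fun _ => g y)) x :=
    (ContinuousMultilinearMap.contDiff _).contDiffAt.comp x (contDiffAt_pi.2 fun _ => hg)
  have h2 : ContDiffAt ℝ r (fun y => (f y).toContinuousMultilinearMap) x :=
    (toContinuousMultilinearMapLI (𝕜 := ℝ) (E := V') (F := ℝ) (ι := Fin k)).contDiff.contDiffAt.comp
      x hf
  exact (ContinuousMultilinearMap.apply ℝ (fun _ : Fin k => V) ℝ v).contDiff.contDiffAt.comp x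
    (h1.clm_apply h2)

/-- The form `contractLast hq A L e` as a continuous linear function of `A`. -/
def contractLastCLM {q k m : ℕ} (hq : q = k + m) (L : V' →L[ℝ] V) (e : Fin m → V)
    [FiniteDimensional ℝ V] : (V [⋀^Fin q]→L[ℝ] ℝ) →L[ℝ] (V' [⋀^Fin k]→L[ℝ] ℝ) :=
  have := finiteDimensional_continuousAlternatingMap (V := V) q
  LinearMap.toContinuousLinearMap
    { toFun := fun A => contractLast hq A L e
      map_add' := fun A B => by ext v; rfl
      map_smul' := fun c A => by ext v; rfl }

theorem contractLast_apply {q k m : ℕ} (hq : q = k + m) (A : V [⋀^Fin q]→L[ℝ] ℝ) (L : V' →L[ℝ] V)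
    (e : Fin m → V) (v : Fin k → V') :
    contractLast hq A L e v = A (fun i => Fin.append (fun j => L (v j)) e (Fin.cast hq i)) := rfl

theorem removeNth_append_cast {X : Type*} {q m n : ℕ} (hq : q = m + n) (hq' : q + 1 = m + 1 + n)
    (a : Fin (m + 1) → X) (e : Fin n → X) (i : Fin (m + 1)) :
    (Fin.cast hq'.symm (Fin.castAdd n i)).removeNth (fun l => Fin.append a e (Fin.cast hq' l)) =
      fun l => Fin.append (i.removeNth a) e (Fin.cast hq l) := by
  subst hq
  funext l
  refine Fin.addCases (fun j => ?_) (fun j => ?_) l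
  · have : Fin.cast hq' ((Fin.cast hq'.symm (Fin.castAdd n i)).succAbove (Fin.castAdd n j)) =
        Fin.castAdd n (i.succAbove j) := by
      ext
      simp only [Fin.succAbove, Fin.lt_def, Fin.val_cast, Fin.val_castSucc, Fin.val_castAdd]
      split_ifs <;> simp
    simp [Fin.removeNth, this]
  · have : Fin.cast hq' ((Fin.cast hq'.symm (Fin.castAdd n i)).succAbove (Fin.natAdd m j)) =
        Fin.natAdd (m + 1) j := by
      ext
      simp only [Fin.succAbove, Fin.lt_def, Fin.val_cast, Fin.val_castSucc, Fin.val_castAdd]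
      split_ifs with h
      · simp at h; omega
      · simp; omega
    simp [Fin.removeNth, this]

/-- Applied to a derivative, this separates an exterior derivative into terms differentiating along
`a` (horizontal) and along `e` (vertical). -/
theorem alternatizeUncurryFin_append {q m n : ℕ} (hq : q = m + n) (hq' : q + 1 = m + 1 + n)
    (L : V →L[ℝ] V [⋀^Fin q]→L[ℝ] ℝ) (a : Fin (m + 1) → V) (e : Fin n → V) :
    alternatizeUncurryFin L (fun l => Fin.append a e (Fin.cast hq' l)) =
      ∑ i : Fin (m + 1), (-1 : ℝ) ^ (i : ℕ) *
          L (a i) (fun l => Fin.append (i.removeNth a) e (Fin.cast hq l)) +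
        ∑ j : Fin n, (-1 : ℝ) ^ (m + 1 + j : ℕ) *
          L (e j) ((Fin.cast hq'.symm (Fin.natAdd (m + 1) j)).removeNth
            (fun l => Fin.append a e (Fin.cast hq' l))) := by
  rw [alternatizeUncurryFin_apply, ← Equiv.sum_comp (finCongr hq'.symm), Fin.sum_univ_add]
  congr 1
  · refine Finset.sum_congr rfl fun i _ => ?_
    rw [finCongr_apply, removeNth_append_cast hq hq']
    simp
  · refine Finset.sum_congr rfl fun i _ => ?_
    rw [finCongr_apply]
    simp

/-- A form of top degree annihilated by a nonzero vector vanishes. -/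
theorem eq_zero_of_top_degree {d : ℕ} (hd : Module.finrank ℝ V = d + 1)
    (Ω : V [⋀^Fin (d + 1)]→L[ℝ] ℝ) (R : V) (hR : R ≠ 0)
    (h : ∀ w : Fin d → V, Ω (Fin.cons R w) = 0) : Ω = 0 := by
  have : FiniteDimensional ℝ V := Module.finite_of_finrank_pos (by omega)
  have hli : LinearIndepOn ℝ id ({R} : Set V) := LinearIndepOn.singleton hR
  let b := Module.Basis.extend hli
  have hfin : Finite (hli.extend (subset_univ _)) := Module.Finite.finite_basis b
  have : Fintype (hli.extend (subset_univ _)) := Fintype.ofFinite _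
  let r : hli.extend (subset_univ _) := ⟨R, hli.subset_extend _ rfl⟩
  have hcard : Fintype.card (hli.extend (subset_univ _)) = d + 1 := by
    rw [← hd, Module.finrank_eq_card_basis b]
  let e0 : hli.extend (subset_univ _) ≃ Fin (d + 1) := Fintype.equivFinOfCardEq hcard
  -- The transposition makes R the basis vector of index 0.
  let e := e0.trans (Equiv.swap (e0 r) 0)
  let c := b.reindex e
  have hc : c 0 = R := by
    have : e.symm 0 = r := by simp [e]
    simp [c, this, b, r]
  apply ContinuousAlternatingMap.toAlternatingMap_injective
  refine (AlternatingMap.map_basis_eq_zero_iff c Ω.toAlternatingMap).1 ?_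
  have : (c : Fin (d + 1) → V) = Fin.cons R (fun i => c i.succ) := by
    rw [← hc]; exact (Fin.cons_self_tail _).symm
  rw [this]
  exact h _

/-- A form vanishes as soon as one argument lies in the span of some others. -/
theorem map_eq_zero_of_mem_span {ι : Type*} [DecidableEq ι] [Finite ι] (A : V [⋀^ι]→L[ℝ] ℝ)
    (v : ι → V) (i : ι) (hi : v i ∈ Submodule.span ℝ (v '' {i}ᶜ)) : A v = 0 := by
  refine A.toAlternatingMap.map_linearDependent v fun h => ?_
  have := linearIndependent_iff_notMem_span.1 h i
  exact this (by simpa [compl_eq_univ_sdiff] using hi)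

theorem map_append_eq_zero_of_mem_span {q k m : ℕ} (hq : q = k + m) (A : V [⋀^Fin q]→L[ℝ] ℝ)
    (v : Fin k → V) (e : Fin m → V) (i : Fin k) (hi : v i ∈ Submodule.span ℝ (range e)) :
    A (fun l => Fin.append v e (Fin.cast hq l)) = 0 := by
  subst hq
  refine map_eq_zero_of_mem_span A _ (Fin.castAdd m i) ?_
  simp only [Fin.cast_eq_self, Fin.append_left]
  refine Submodule.span_mono ?_ hi
  rintro _ ⟨j, rfl⟩
  refine ⟨Fin.natAdd k j, ?_, by simp⟩
  simp only [mem_compl_iff, mem_singleton_iff, Fin.ext_iff, Fin.val_natAdd, Fin.val_castAdd]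
  omega

/-- The contraction of a form with `e₁, …, e_m` does not change if its arguments are modified by
vectors in the span of the `e_i`. -/
theorem map_append_eq_of_sub_mem_span {q k m : ℕ} (hq : q = k + m) (A : V [⋀^Fin q]→L[ℝ] ℝ)
    (v w : Fin k → V) (e : Fin m → V) (h : ∀ i, w i - v i ∈ Submodule.span ℝ (range e)) :
    A (fun l => Fin.append w e (Fin.cast hq l)) = A (fun l => Fin.append v e (Fin.cast hq l)) := by
  have h0 := (contractLast hq A (ContinuousLinearMap.id ℝ V) e).toMultilinearMap.map_add_univ
    v (w - v)
  rw [add_sub_cancel] at h0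
  -- In the multilinear expansion over subsets s of the slots, every s other than the full set
  -- leaves a slot filled with a difference w i - v i from the span.
  refine h0.trans ((Finset.sum_eq_single Finset.univ ?_ ?_).trans ?_)
  · intro s _ hs
    obtain ⟨i, hi⟩ : ∃ i, i ∉ s := by
      by_contra! hcon
      exact hs (Finset.eq_univ_iff_forall.2 hcon)
    refine map_append_eq_zero_of_mem_span hq A _ e i ?_
    simpa [Finset.piecewise_eq_of_notMem _ _ _ hi] using h i
  · simp
  · simp only [Finset.piecewise_univ]
    rfl

theorem append_update_right_cast {X : Type*} {q k m : ℕ} (hq : q = k + m) [DecidableEq (Fin m)]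
    [DecidableEq (Fin q)] (v : Fin k → X) (e : Fin m → X) (i : Fin m) (z : X) :
    (fun l => Fin.append v (Function.update e i z) (Fin.cast hq l)) =
      Function.update (fun l => Fin.append v e (Fin.cast hq l))
        (Fin.cast hq.symm (Fin.natAdd k i)) z := by
  subst hq
  funext l
  refine Fin.addCases (fun j => ?_) (fun j => ?_) l
  · have h : Fin.castAdd m j ≠ Fin.natAdd k i := by
      intro h
      have := congrArg Fin.val h
      simp only [Fin.val_natAdd, Fin.val_castAdd] at this
      omega
    simp [h]
  · by_cases hj : j = i <;> simp [hj]

/-- The alternating map obtained from a form by fixing its first arguments. -/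
def fixFirst {q k m : ℕ} (hq : q = k + m) (A : V [⋀^Fin q]→L[ℝ] ℝ) (v : Fin k → V) :
    V [⋀^Fin m]→ₗ[ℝ] ℝ where
  toFun e := A (fun l => Fin.append v e (Fin.cast hq l))
  map_update_add' := by
    intro _ e i x y
    simp only [append_update_right_cast hq, ContinuousAlternatingMap.map_update_add]
  map_update_smul' := by
    intro _ e i c x
    simp only [append_update_right_cast hq, ContinuousAlternatingMap.map_update_smul]
  map_eq_zero_of_eq' := by
    intro e i j hv hij
    exact A.map_eq_zero_of_eq _ (i := Fin.cast hq.symm (Fin.natAdd k i))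
      (j := Fin.cast hq.symm (Fin.natAdd k j)) (by simp [hv])
      (by simpa [Fin.ext_iff] using hij)

/-- In its last m slots, composed with S, the form is alternating of top degree on V', hence a
multiple of the determinant. -/
theorem map_append_comp_linearMap {q k m : ℕ} (hq : q = k + m) (A : V [⋀^Fin q]→L[ℝ] ℝ)
    (v : Fin k → V) (b : Module.Basis (Fin m) ℝ V') (S : V' →ₗ[ℝ] V) (T : V' →ₗ[ℝ] V') :
    A (fun l => Fin.append v (fun i => S (T (b i))) (Fin.cast hq l)) =
      LinearMap.det T * A (fun l => Fin.append v (fun i => S (b i)) (Fin.cast hq l)) := by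
  have h := AlternatingMap.eq_smul_basis_det b ((fixFirst hq A v).compLinearMap S)
  have h1 := DFunLike.congr_fun h (fun i => T (b i))
  have h2 : b.det (fun i => T (b i)) = LinearMap.det T := by
    have := b.det_comp T b
    rw [Module.Basis.det_self, mul_one] at this
    exact this
  rw [AlternatingMap.smul_apply, h2, smul_eq_mul, mul_comm] at h1
  exact h1

/-- The wedge product of a `1`-form and a `k`-form on a vector space. -/
def wedgeOneForm {k : ℕ} (χ : V [⋀^Fin 1]→L[ℝ] ℝ) (θ : V [⋀^Fin k]→L[ℝ] ℝ) :
    V [⋀^Fin (k + 1)]→L[ℝ] ℝ :=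
  alternatizeUncurryFin (((ofSubsingleton ℝ V ℝ (0 : Fin 1)).symm χ).smulRight θ)

theorem wedgeOneForm_apply {k : ℕ} (χ : V [⋀^Fin 1]→L[ℝ] ℝ) (θ : V [⋀^Fin k]→L[ℝ] ℝ)
    (v : Fin (k + 1) → V) :
    wedgeOneForm χ θ v =
      ∑ i : Fin (k + 1), (-1 : ℝ) ^ (i : ℕ) * (χ (fun _ => v i) * θ (i.removeNth v)) := by
  simp [wedgeOneForm, alternatizeUncurryFin_apply]

theorem wedgeOneForm_compContinuousLinearMap {k : ℕ} (χ : V [⋀^Fin 1]→L[ℝ] ℝ)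
    (θ : V [⋀^Fin k]→L[ℝ] ℝ) (L : V' →L[ℝ] V) :
    (wedgeOneForm χ θ).compContinuousLinearMap L =
      wedgeOneForm (χ.compContinuousLinearMap L) (θ.compContinuousLinearMap L) := by
  ext v
  simp only [compContinuousLinearMap_apply, wedgeOneForm_apply]
  rfl

/-- In every term but the first, R remains as an argument of θ. -/
theorem wedgeOneForm_cons {k : ℕ} (χ : V [⋀^Fin 1]→L[ℝ] ℝ) (θ : V [⋀^Fin k]→L[ℝ] ℝ) (R : V)
    (hθ : ∀ v : Fin k → V, (∃ i, v i = R) → θ v = 0) (w : Fin k → V) :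
    wedgeOneForm χ θ (Fin.cons R w) = χ (fun _ => R) * θ w := by
  rw [wedgeOneForm_apply, Fin.sum_univ_succ, Finset.sum_eq_zero, add_zero]
  · simp
  · intro i _
    rw [hθ, mul_zero, mul_zero]
    have hk : 0 < k := i.pos
    refine ⟨⟨0, hk⟩, ?_⟩
    have : i.succ.succAbove ⟨0, hk⟩ = 0 := by
      ext
      simp [Fin.succAbove, Fin.lt_def]
    simp [Fin.removeNth, this]

theorem contDiffAt_wedgeOneForm [FiniteDimensional ℝ V] {k : ℕ} {r : WithTop ℕ∞}
    {χ : W → V [⋀^Fin 1]→L[ℝ] ℝ} {θ : W → V [⋀^Fin k]→L[ℝ] ℝ} {x : W}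
    (hχ : ContDiffAt ℝ r χ x) (hθ : ContDiffAt ℝ r θ x) :
    ContDiffAt ℝ r (fun y => wedgeOneForm (χ y) (θ y)) x := by
  refine contDiffAt_continuousAlternatingMap fun v => ?_
  simp only [wedgeOneForm_apply]
  refine ContDiffAt.sum fun i _ => contDiffAt_const.mul ?_
  exact (hχ.continuousAlternatingMap_apply_const _).mul (hθ.continuousAlternatingMap_apply_const _)

end Alternating

/-! ### The flow of the radial vector field on a product of vector spaces -/

section Flow

open ContinuousAlternatingMap

variable {X Y : Type*} [NormedAddCommGroup X] [NormedSpace ℝ X] [NormedAddCommGroup Y]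
  [NormedSpace ℝ Y]

/-- The flow `(t, (x, y)) ↦ (x, e^t y)` of the radial vector field. -/
def radialFlow (p : ℝ × (X × Y)) : X × Y := (p.2.1, Real.exp p.1 • p.2.2)

/-- The linear map `(x, y) ↦ (x, e^t y)`. -/
def radialFlowCLM (X Y : Type*) [NormedAddCommGroup X] [NormedSpace ℝ X] [NormedAddCommGroup Y]
    [NormedSpace ℝ Y] (t : ℝ) : X × Y →L[ℝ] X × Y :=
  (ContinuousLinearMap.id ℝ X).prodMap (Real.exp t • ContinuousLinearMap.id ℝ Y)

theorem radialFlowCLM_apply (t : ℝ) (z : X × Y) :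
    radialFlowCLM X Y t z = (z.1, Real.exp t • z.2) := rfl

theorem contDiff_radialFlow {r : WithTop ℕ∞} : ContDiff ℝ r (radialFlow : ℝ × (X × Y) → X × Y) := by
  unfold radialFlow
  exact (contDiff_fst.comp contDiff_snd).prodMk
    ((Real.contDiff_exp.comp contDiff_fst).smul (contDiff_snd.comp contDiff_snd))

theorem fderiv_radialFlow_apply (t : ℝ) (z : X × Y) (a : ℝ) (w : X × Y) :
    fderiv ℝ (radialFlow : ℝ × (X × Y) → X × Y) (t, z) (a, w) =
      radialFlowCLM X Y t (w + (0, a • z.2)) := by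
  have h1 : HasFDerivAt (fun p : ℝ × (X × Y) => Real.exp p.1)
      (Real.exp t • ContinuousLinearMap.fst ℝ ℝ (X × Y)) (t, z) :=
    (hasFDerivAt_fst (𝕜 := ℝ) (p := (t, z))).exp
  have h2 : HasFDerivAt (fun p : ℝ × (X × Y) => p.2.2)
      ((ContinuousLinearMap.snd ℝ X Y).comp (ContinuousLinearMap.snd ℝ ℝ (X × Y))) (t, z) :=
    ((ContinuousLinearMap.snd ℝ X Y).comp (ContinuousLinearMap.snd ℝ ℝ (X × Y))).hasFDerivAt
  have h3 : HasFDerivAt (fun p : ℝ × (X × Y) => p.2.1)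
      ((ContinuousLinearMap.fst ℝ X Y).comp (ContinuousLinearMap.snd ℝ ℝ (X × Y))) (t, z) :=
    ((ContinuousLinearMap.fst ℝ X Y).comp (ContinuousLinearMap.snd ℝ ℝ (X × Y))).hasFDerivAt
  have h4 : HasFDerivAt (radialFlow : ℝ × (X × Y) → X × Y) _ (t, z) := h3.prodMk (h1.smul h2)
  rw [h4.fderiv]
  ext
  · simp [radialFlowCLM_apply]
  · simp [radialFlowCLM_apply, smul_smul, mul_comm]

/-- The pull-back of a form by the flow of the radial vector field. -/
def flowPullback {k : ℕ} (α : X × Y → (X × Y) [⋀^Fin k]→L[ℝ] ℝ) (p : ℝ × (X × Y)) :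
    (ℝ × (X × Y)) [⋀^Fin k]→L[ℝ] ℝ :=
  (α (radialFlow p)).compContinuousLinearMap (fderiv ℝ radialFlow p)

/-- The arguments `(∂/∂t, w₁, …, w_k)` of a form on `ℝ × (X × Y)`. -/
def timeCons {k : ℕ} (w : Fin k → X × Y) : Fin (k + 1) → ℝ × (X × Y) :=
  Fin.cons (1, 0) fun i => (0, w i)

theorem timeCons_removeNth_zero {k : ℕ} (w : Fin k → X × Y) :
    (0 : Fin (k + 1)).removeNth (timeCons w) = fun i => (0, w i) := by
  simp [timeCons]

theorem timeCons_removeNth_succ {k : ℕ} (w : Fin (k + 1) → X × Y) (j : Fin (k + 1)) :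
    j.succ.removeNth (timeCons w) = timeCons (j.removeNth w) := by
  funext l
  refine Fin.cases ?_ (fun l => ?_) l
  · simp [timeCons, Fin.removeNth]
  · simp [timeCons, Fin.removeNth, Fin.succ_succAbove_succ]

theorem flowPullback_space {k : ℕ} (α : X × Y → (X × Y) [⋀^Fin k]→L[ℝ] ℝ) (t : ℝ) (z : X × Y)
    (w : Fin k → X × Y) :
    flowPullback α (t, z) (fun i => (0, w i)) =
      α (radialFlow (t, z)) fun i => radialFlowCLM X Y t (w i) := by
  simp only [flowPullback, compContinuousLinearMap_apply]
  congr 1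
  funext i
  simp [fderiv_radialFlow_apply, Prod.mk_zero_zero]

theorem flowPullback_timeCons {k : ℕ} (α : X × Y → (X × Y) [⋀^Fin (k + 1)]→L[ℝ] ℝ) (t : ℝ)
    (z : X × Y) (w : Fin k → X × Y) :
    flowPullback α (t, z) (timeCons w) =
      α (radialFlow (t, z)) (Fin.cons (0, (radialFlow (t, z)).2)
        fun i => radialFlowCLM X Y t (w i)) := by
  simp only [flowPullback, compContinuousLinearMap_apply]
  congr 1
  funext i
  refine Fin.cases ?_ (fun i => ?_) i
  · simp [timeCons, fderiv_radialFlow_apply, radialFlowCLM_apply, radialFlow]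
  · simp [timeCons, fderiv_radialFlow_apply, Prod.mk_zero_zero]

theorem contDiffAt_flowPullback [FiniteDimensional ℝ X] [FiniteDimensional ℝ Y] {k : ℕ}
    {r : WithTop ℕ∞} {α : X × Y → (X × Y) [⋀^Fin k]→L[ℝ] ℝ} {p : ℝ × (X × Y)}
    (hα : ContDiffAt ℝ r α (radialFlow p)) : ContDiffAt ℝ r (flowPullback α) p := by
  refine ContDiffAt.continuousAlternatingMap_compContinuousLinearMap ?_ ?_
  · exact hα.comp p contDiff_radialFlow.contDiffAt
  · exact (contDiff_radialFlow (r := r + 1)).contDiffAt.fderiv_right le_rfl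

/-- Cartan's formula for the radial vector field, integrated along the flow. -/
theorem extDeriv_radialFlow [FiniteDimensional ℝ X] [FiniteDimensional ℝ Y] {k : ℕ}
    {α : X × Y → (X × Y) [⋀^Fin k]→L[ℝ] ℝ} {t : ℝ} {z : X × Y}
    (hα : ContDiffAt ℝ 1 α (radialFlow (t, z))) (w : Fin k → X × Y) :
    extDeriv α (radialFlow (t, z)) (Fin.cons (0, (radialFlow (t, z)).2)
        fun i => radialFlowCLM X Y t (w i)) =
      fderiv ℝ (fun s => flowPullback α (s, z) fun i => (0, w i)) t 1 +
        ∑ j : Fin k, (-1 : ℝ) ^ (j + 1 : ℕ) *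
          fderiv ℝ (fun z' => flowPullback α (t, z') (j.succ.removeNth (timeCons w))) z (w j) := by
  have hW : DifferentiableAt ℝ (flowPullback α) (t, z) :=
    (contDiffAt_flowPullback hα).differentiableAt one_ne_zero
  have hWv : ∀ v, DifferentiableAt ℝ (fun p => flowPullback α p v) (t, z) := fun v =>
    (ContinuousAlternatingMap.apply ℝ _ ℝ v).differentiableAt.comp (t, z) hW
  -- Naturality of d for the map (t, z) ↦ φ_t z, evaluated on (∂/∂t, w). The arguments being
  -- constant, no bracket terms appear: slot 0 gives the time derivative, the others give d of the
  -- contraction with ℛ.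
  have h1 := extDeriv_pullback (hα.differentiableAt one_ne_zero)
    (contDiff_radialFlow (r := 2)).contDiffAt (minSmoothness_of_isRCLikeNormedField (𝕜 := ℝ)).le
  have h2 := DFunLike.congr_fun h1 (timeCons w)
  have h3 : ((extDeriv α (radialFlow (t, z))).compContinuousLinearMap
      (fderiv ℝ radialFlow (t, z))) (timeCons w) =
      extDeriv α (radialFlow (t, z)) (Fin.cons (0, (radialFlow (t, z)).2)
        fun i => radialFlowCLM X Y t (w i)) := flowPullback_timeCons (extDeriv α) t z w
  rw [← h3, ← h2]
  change extDeriv (flowPullback α) (t, z) (timeCons w) = _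
  rw [extDeriv_apply hW, Fin.sum_univ_succ]
  congr 1
  · rw [timeCons_removeNth_zero]
    have h4 := (hWv fun i => (0, w i)).hasFDerivAt.comp (f := fun s : ℝ => (s, z)) t
      ((hasFDerivAt_id t).prodMk (hasFDerivAt_const z t))
    have h5 : fderiv ℝ (fun s => flowPullback α (s, z) fun i => (0, w i)) t = _ := h4.fderiv
    rw [h5]
    simp [timeCons]
  · refine Finset.sum_congr rfl fun j _ => ?_
    have h4 := (hWv (j.succ.removeNth (timeCons w))).hasFDerivAt.comp
      (f := fun z' : X × Y => (t, z')) z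
      ((hasFDerivAt_const t z).prodMk (hasFDerivAt_id z))
    have h5 : fderiv ℝ (fun z' => flowPullback α (t, z') (j.succ.removeNth (timeCons w))) z = _ :=
      h4.fderiv
    rw [h5]
    simp [timeCons]

/-- A closed form annihilated by the radial vector field is invariant under its flow. -/
theorem radialFlow_invariant [FiniteDimensional ℝ X] [FiniteDimensional ℝ Y] {k : ℕ}
    {O : Set (X × Y)} (hO : IsOpen O) (hOt : ∀ z ∈ O, ∀ t : ℝ, radialFlow (t, z) ∈ O)
    {θ : X × Y → (X × Y) [⋀^Fin k]→L[ℝ] ℝ} (hθ : ∀ z ∈ O, ContDiffAt ℝ 1 θ z)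
    (hd : ∀ z ∈ O, extDeriv θ z = 0)
    (hR : ∀ z ∈ O, ∀ v : Fin k → X × Y, (∃ i, v i = (0, z.2)) → θ z v = 0)
    {z : X × Y} (hz : z ∈ O) (t : ℝ) (w : Fin k → X × Y) :
    θ (radialFlow (t, z)) (fun i => radialFlowCLM X Y t (w i)) = θ z w := by
  have hdiff : Differentiable ℝ fun s => flowPullback θ (s, z) fun i => (0, w i) := by
    intro s
    have h1 : ContDiffAt ℝ 1 (flowPullback θ) (s, z) := contDiffAt_flowPullback (hθ _ (hOt z hz s))
    have h2 := (h1.continuousAlternatingMap_apply_const fun i => (0, w i)).differentiableAt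
      one_ne_zero
    exact h2.comp (f := fun s : ℝ => (s, z)) s (by fun_prop)
  -- Cartan's formula: the Lie derivative of θ is i_ℛ dθ + d(i_ℛ θ), and both terms vanish.
  have hzero : ∀ s, fderiv ℝ (fun s => flowPullback θ (s, z) fun i => (0, w i)) s 1 = 0 := by
    intro s
    have h1 := extDeriv_radialFlow (hθ _ (hOt z hz s)) w
    rw [hd _ (hOt z hz s), Finset.sum_eq_zero, add_zero] at h1
    · exact h1.symm
    · intro j _
      have : (fun z' => flowPullback θ (s, z') (j.succ.removeNth (timeCons w))) =ᶠ[𝓝 z]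
          fun _ => (0 : ℝ) := by
        filter_upwards [hO.mem_nhds hz] with z' hz'
        rw [flowPullback, compContinuousLinearMap_apply]
        refine hR _ (hOt z' hz' s) _ ⟨⟨0, j.pos⟩, ?_⟩
        have hj : j.succ.succAbove ⟨0, j.pos⟩ = 0 := by
          ext
          simp [Fin.succAbove, Fin.lt_def]
        simp [Fin.removeNth, hj, timeCons, fderiv_radialFlow_apply, radialFlowCLM_apply, radialFlow]
      rw [this.fderiv_eq]
      simp
  have h := is_const_of_deriv_eq_zero hdiff (fun s => hzero s) t 0
  rw [flowPullback_space, flowPullback_space] at h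
  rw [h]
  simp [radialFlow, radialFlowCLM_apply]

end Flow

/-! ### Integration along the orbits of the radial flow -/

section Flow

open ContinuousAlternatingMap

variable {X Y : Type*} [NormedAddCommGroup X] [NormedSpace ℝ X] [NormedAddCommGroup Y]
  [NormedSpace ℝ Y]

/-- Over a bounded range of non-zero vectors, the flow meets a compact set without zero vectors only
for a bounded range of times. -/
theorem exists_compact_times {C : Set (X × Y)} (hC : IsCompact C) (hC0 : ∀ z ∈ C, z.2 ≠ 0)
    {δ D : ℝ} (hδ : 0 < δ) :
    ∃ K : Set ℝ, IsCompact K ∧ ∀ z : X × Y, δ < ‖z.2‖ → ‖z.2‖ < D → ∀ t, t ∉ K →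
      radialFlow (t, z) ∉ C := by
  have hcont : ContinuousOn (fun z : X × Y => ‖z.2‖) C := by fun_prop
  obtain ⟨a, ha0, ha⟩ : ∃ a : ℝ, 0 < a ∧ ∀ z ∈ C, a ≤ ‖z.2‖ := by
    rcases C.eq_empty_or_nonempty with rfl | hne
    · exact ⟨1, one_pos, by simp⟩
    · obtain ⟨z, hz, hmin⟩ := hC.exists_isMinOn hne hcont
      exact ⟨‖z.2‖, norm_pos_iff.2 (hC0 z hz), fun z' hz' => hmin hz'⟩
  obtain ⟨b, hb⟩ := hC.bddAbove_image hcont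
  -- The flow multiplies the norm of the fibre component by e^t, so meeting C forces a ≤ e^t ‖z.2‖ ≤
  -- b, with δ < ‖z.2‖ < D.
  refine ⟨Icc (Real.log (a / D)) (Real.log (b / δ)), isCompact_Icc, ?_⟩
  intro z h1 h2 t ht hmem
  have h3 : a ≤ Real.exp t * ‖z.2‖ := by
    simpa [radialFlow, norm_smul] using ha _ hmem
  have h4 : Real.exp t * ‖z.2‖ ≤ b := by
    simpa [radialFlow, norm_smul] using hb (mem_image_of_mem _ hmem)
  have hD : 0 < D := by linarith
  have he := Real.exp_pos t
  refine ht ⟨?_, ?_⟩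
  · rw [Real.log_le_iff_le_exp (by positivity), div_le_iff₀ hD]
    nlinarith
  · rw [Real.le_log_iff_exp_le (div_pos (by nlinarith) hδ), le_div_iff₀ hδ]
    nlinarith

variable [FiniteDimensional ℝ X] [FiniteDimensional ℝ Y]

theorem extDeriv_eq_zero_of_notMem_compact {k : ℕ} {α : X × Y → (X × Y) [⋀^Fin k]→L[ℝ] ℝ}
    {G : Set X} (hG : IsOpen G) {C : Set (X × Y)} (hC : IsCompact C)
    (hα0 : ∀ z : X × Y, z.1 ∈ G → z ∉ C → α z = 0) {z : X × Y} (hzG : z.1 ∈ G) (hz : z ∉ C) :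
    extDeriv α z = 0 := by
  have : α =ᶠ[𝓝 z] fun _ => 0 := by
    filter_upwards [(hG.preimage continuous_fst).mem_nhds hzG,
      hC.isClosed.isOpen_compl.mem_nhds hz] with z' h1 h2 using hα0 z' h1 h2
  rw [this.extDeriv_eq, extDeriv]
  simp only [fderiv_fun_const, Pi.zero_apply]
  ext v
  simp [alternatizeUncurryFin_apply]

theorem continuousOn_extDeriv {V : Type*} [NormedAddCommGroup V] [NormedSpace ℝ V] {k : ℕ}
    {α : V → V [⋀^Fin k]→L[ℝ] ℝ} {s : Set V} (hs : IsOpen s) (hα : ContDiffOn ℝ 1 α s) :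
    ContinuousOn (extDeriv α) s :=
  (alternatizeUncurryFinCLM ℝ V ℝ).continuous.comp_continuousOn
    (hα.continuousOn_fderiv_of_isOpen hs le_rfl)

/-- The integral along the orbits of the radial vector field of the exterior derivative of `χ ∧ θ`,
contracted with the radial vector field, vanishes. -/
theorem integral_extDeriv_radialFlow_eq_zero {k : ℕ}
    {O : Set (X × Y)} (hO : IsOpen O) (hOt : ∀ z ∈ O, ∀ t : ℝ, radialFlow (t, z) ∈ O)
    (hO0 : ∀ z ∈ O, z.2 ≠ 0)
    {θ : X × Y → (X × Y) [⋀^Fin k]→L[ℝ] ℝ} (hθ : ∀ z ∈ O, ContDiffAt ℝ 1 θ z)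
    (hd : ∀ z ∈ O, extDeriv θ z = 0)
    (hR : ∀ z ∈ O, ∀ v : Fin k → X × Y, (∃ i, v i = (0, z.2)) → θ z v = 0)
    {χ : X × Y → (X × Y) [⋀^Fin 1]→L[ℝ] ℝ}
    (hχ : ∀ z ∈ O, ∫ t : ℝ, χ (radialFlow (t, z)) (fun _ => (0, (radialFlow (t, z)).2)) = 1)
    {α : X × Y → (X × Y) [⋀^Fin (k + 1)]→L[ℝ] ℝ} (hα : ∀ z ∈ O, α z = wedgeOneForm (χ z) (θ z))
    {G : Set X} (hG : IsOpen G) {C : Set (X × Y)} (hC : IsCompact C) (hCO : C ⊆ O)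
    (hα0 : ∀ z : X × Y, z.1 ∈ G → z ∉ C → α z = 0) (hαs : ∀ z : X × Y, z.1 ∈ G → ContDiffAt ℝ 1 α z)
    {z : X × Y} (hz : z ∈ O) (hzG : z.1 ∈ G) (w : Fin (k + 1) → X × Y) :
    ∫ t : ℝ, extDeriv α (radialFlow (t, z)) (Fin.cons (0, (radialFlow (t, z)).2)
        fun i => radialFlowCLM X Y t (w i)) = 0 := by
  have hy : 0 < ‖z.2‖ := norm_pos_iff.2 (hO0 z hz)
  -- The factors 1/2 and 2 leave room to vary z: one K must serve a whole neighbourhood, because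
  -- derivatives in z are taken under the integral over t.
  obtain ⟨K, hK, hKC⟩ := exists_compact_times (δ := ‖z.2‖ / 2) (D := 2 * ‖z.2‖) hC
    (fun z hz => hO0 z (hCO hz)) (by positivity)
  -- a neighbourhood of `z` on which the relevant times are uniformly bounded
  let N : Set (X × Y) := {z' | z' ∈ O ∧ z'.1 ∈ G ∧ ‖z.2‖ / 2 < ‖z'.2‖ ∧ ‖z'.2‖ < 2 * ‖z.2‖}
  have hN : IsOpen N := by
    refine hO.inter ((hG.preimage continuous_fst).inter ?_)
    exact (isOpen_lt continuous_const continuous_snd.norm).inter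
      (isOpen_lt continuous_snd.norm continuous_const)
  have hzN : z ∈ N := ⟨hz, hzG, by linarith, by linarith⟩
  have hN0 : ∀ z' ∈ N, ∀ t, t ∉ K → α (radialFlow (t, z')) = 0 := fun z' hz' t ht =>
    hα0 _ hz'.2.1 (hKC z' hz'.2.2.1 hz'.2.2.2 t ht)
  have hW : ∀ z' ∈ N, ∀ t, ContDiffAt ℝ 1 (flowPullback α) (t, z') := fun z' hz' t =>
    contDiffAt_flowPullback (hαs _ hz'.2.1)
  have hW0 : ∀ z' ∈ N, ∀ t, t ∉ K → ∀ v, flowPullback α (t, z') v = 0 := fun z' hz' t ht v => by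
    simp [flowPullback, compContinuousLinearMap_apply, hN0 z' hz' t ht]
  -- the boundary term
  let f : ℝ → ℝ := fun s => flowPullback α (s, z) fun i => (0, w i)
  have hf : ContDiff ℝ 1 f := contDiff_iff_contDiffAt.2 fun s =>
    ((hW z hzN s).continuousAlternatingMap_apply_const _).comp (f := fun s : ℝ => (s, z)) s
      (by fun_prop)
  have hf0 : ∀ s, s ∉ K → f s = 0 := fun s hs => hW0 z hzN s hs _
  have hfint : ∫ t, fderiv ℝ f t 1 = 0 := integral_fderiv_eq_zero_of_compactSupport hK hf0 hf 1
  have hfI : Integrable (fun t => fderiv ℝ f t 1) := by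
    refine integrable_of_compactSupport hK (fun t ht => ?_)
      ((hf.continuous_fderiv one_ne_zero).clm_apply continuous_const)
    have : f =ᶠ[𝓝 t] fun _ => 0 := by
      filter_upwards [hK.isClosed.isOpen_compl.mem_nhds ht] with s hs using hf0 s hs
    rw [this.fderiv_eq]
    simp
  -- the other terms
  let h : Fin (k + 1) → X × Y → ℝ → ℝ := fun j z' t =>
    flowPullback α (t, z') (j.succ.removeNth (timeCons w))
  have hh : ∀ j, ContDiffOn ℝ 1 (Function.uncurry (h j)) (N ×ˢ univ) := fun j p hp =>
    (((hW p.1 hp.1 p.2).continuousAlternatingMap_apply_const _).comp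
      (f := fun p : (X × Y) × ℝ => (p.2, p.1)) p (by fun_prop)).contDiffWithinAt
  have hh0 : ∀ j, ∀ z', ∀ t, z' ∈ N → t ∉ K → h j z' t = 0 := fun j z' t hz' ht =>
    hW0 z' hz' t ht _
  -- Contracting χ ∧ θ with ℛ gives χ(ℛ) θ, and θ is flow-invariant, so all dependence on t sits in
  -- the scalar χ(ℛ).
  have hhθ : ∀ j, ∀ z' ∈ N, ∀ t, h j z' t =
      χ (radialFlow (t, z')) (fun _ => (0, (radialFlow (t, z')).2)) * θ z' (j.removeNth w) := by
    intro j z' hz' t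
    simp only [h]
    rw [timeCons_removeNth_succ, flowPullback_timeCons, hα _ (hOt z' hz'.1 t),
      wedgeOneForm_cons _ _ _ (hR _ (hOt z' hz'.1 t)),
      radialFlow_invariant hO hOt hθ hd hR hz'.1]
  have hhint : ∀ j, ∀ z' ∈ N, ∫ t, h j z' t = θ z' (j.removeNth w) := by
    intro j z' hz'
    simp only [hhθ j z' hz']
    rw [integral_mul_const, hχ z' hz'.1, one_mul]
  have hpart : ∀ j t, fderiv ℝ (fun z' => h j z' t) z (w j) =
      fderiv ℝ (Function.uncurry (h j)) (z, t) (w j, 0) := by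
    intro j t
    have h1 : DifferentiableAt ℝ (Function.uncurry (h j)) (z, t) :=
      ((hh j).contDiffAt ((hN.prod isOpen_univ).mem_nhds ⟨hzN, mem_univ _⟩)).differentiableAt
        one_ne_zero
    have h2 := h1.hasFDerivAt.comp (f := fun z' : X × Y => (z', t)) z
      ((hasFDerivAt_id z).prodMk (hasFDerivAt_const t z))
    have h3 : fderiv ℝ (fun z' => h j z' t) z = _ := h2.fderiv
    rw [h3]
    simp
  -- Differentiation under the integral, after which the normalisation of χ leaves a derivative of θ
  -- alone.
  have hhD : ∀ j, ∫ t, fderiv ℝ (fun z' => h j z' t) z (w j) =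
      fderiv ℝ (fun z' => θ z' (j.removeNth w)) z (w j) := by
    intro j
    simp only [hpart j]
    rw [← fderiv_integral_of_compactSupport hN hK (hh0 j) (hh j) hzN]
    have : (fun z' => ∫ t, h j z' t) =ᶠ[𝓝 z] fun z' => θ z' (j.removeNth w) := by
      filter_upwards [hN.mem_nhds hzN] with z' hz' using hhint j z' hz'
    rw [this.fderiv_eq]
  have hhI : ∀ j, Integrable fun t => fderiv ℝ (fun z' => h j z' t) z (w j) := by
    intro j
    simp only [hpart j]
    refine integrable_of_compactSupport hK (fun t ht => ?_)
      ((continuous_fderiv_prodMk hN (hh j) hzN).clm_apply continuous_const)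
    rw [fderiv_eq_zero_of_notMem_compact hN hK (hh0 j) hzN ht]
    simp
  calc ∫ t : ℝ, extDeriv α (radialFlow (t, z)) (Fin.cons (0, (radialFlow (t, z)).2)
        fun i => radialFlowCLM X Y t (w i))
      = ∫ t : ℝ, (fderiv ℝ f t 1 + ∑ j : Fin (k + 1), (-1 : ℝ) ^ (j + 1 : ℕ) *
          fderiv ℝ (fun z' => h j z' t) z (w j)) :=
        integral_congr_ae (Eventually.of_forall fun t =>
          extDeriv_radialFlow (hαs (radialFlow (t, z)) hzG) w)
    _ = ∑ j : Fin (k + 1), (-1 : ℝ) ^ (j + 1 : ℕ) *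
          fderiv ℝ (fun z' => θ z' (j.removeNth w)) z (w j) := by
        rw [integral_add hfI (integrable_finsetSum _ fun j _ => (hhI j).const_mul _), hfint,
          zero_add, integral_finsetSum _ fun j _ => (hhI j).const_mul _]
        refine Finset.sum_congr rfl fun j _ => ?_
        rw [integral_const_mul, hhD j]
    _ = - extDeriv θ z w := by
        rw [extDeriv_apply ((hθ z hz).differentiableAt one_ne_zero), ← Finset.sum_neg_distrib]
        refine Finset.sum_congr rfl fun j _ => ?_
        simp [pow_succ]
    _ = 0 := by rw [hd z hz]; simp

end Flow

/-! ### Fibre integrals on a product of vector spaces -/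

section FibreIntegral

open ContinuousAlternatingMap

variable {X Y : Type*} [NormedAddCommGroup X] [NormedSpace ℝ X] [NormedAddCommGroup Y]
  [NormedSpace ℝ Y] [FiniteDimensional ℝ X] [FiniteDimensional ℝ Y] {m n : ℕ}

/-- The arguments `((v₁, 0), …, (v_k, 0), (0, b₁), …, (0, b_n))` of a form on `X × Y`. -/
def splitArgs {q k : ℕ} (hq : q = k + n) (b : Module.Basis (Fin n) ℝ Y) (v : Fin k → X) :
    Fin q → X × Y :=
  fun l => Fin.append (fun i => (v i, (0 : Y))) (fun i => ((0 : X), b i)) (Fin.cast hq l)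

/-- The integral over t of the pull-backs of β t by the linear flow is a top-degree form on X × Y.
The hypothesis says that (0, y) annihilates it, so it is zero. On split arguments the linear flow
fixes the X-vectors and scales the n vectors of Y, which produces the weight e^(nt). -/
theorem integral_ray_eq_zero {k : ℕ} (hq : k + 1 + 1 = m + 1 + n) (hX : Module.finrank ℝ X = m + 1)
    (b : Module.Basis (Fin n) ℝ Y)
    {β : ℝ → (X × Y) [⋀^Fin (k + 1 + 1)]→L[ℝ] ℝ} (hβ : Continuous β) {K : Set ℝ} (hK : IsCompact K)
    (hβ0 : ∀ t, t ∉ K → β t = 0) {y : Y} (hy : y ≠ 0)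
    (h : ∀ w : Fin (k + 1) → X × Y, ∫ t : ℝ, β t (Fin.cons (0, Real.exp t • y)
        fun i => radialFlowCLM X Y t (w i)) = 0) (v : Fin (m + 1) → X) :
    ∫ t : ℝ, Real.exp t ^ n * β t (splitArgs hq b v) = 0 := by
  let β' : ℝ → (X × Y) [⋀^Fin (k + 1 + 1)]→L[ℝ] ℝ := fun t =>
    (β t).compContinuousLinearMap (radialFlowCLM X Y t)
  have hM : ContDiff ℝ 0 (fun t => radialFlowCLM X Y t) := by
    rw [contDiff_zero]
    refine continuous_clm_apply.2 fun z => ?_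
    simp only [radialFlowCLM_apply]
    fun_prop
  have hβ'c : Continuous β' := contDiff_zero (𝕜 := ℝ).1 (contDiff_iff_contDiffAt.2 fun t =>
    ((contDiff_zero (𝕜 := ℝ).2 hβ).contDiffAt).continuousAlternatingMap_compContinuousLinearMap
      hM.contDiffAt)
  have hβ'0 : ∀ t, t ∉ K → β' t = 0 := fun t ht => by
    ext v
    simp [β', hβ0 t ht]
  have hI : Integrable β' := integrable_of_compactSupport hK hβ'0 hβ'c
  have happ : ∀ u, (∫ t, β' t) u = ∫ t, β' t u := fun u =>
    ((ContinuousAlternatingMap.apply ℝ (X × Y) ℝ u).integral_comp_comm hI).symm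
  have hfin : Module.finrank ℝ (X × Y) = k + 1 + 1 := by
    rw [Module.finrank_prod, hX, Module.finrank_eq_card_basis b, Fintype.card_fin, hq]
  have hΩ : (∫ t, β' t) = 0 := by
    refine eq_zero_of_top_degree hfin _ ((0 : X), y) (by simpa using hy) fun w => ?_
    rw [happ, ← h w]
    refine integral_congr_ae (Eventually.of_forall fun t => ?_)
    simp only [β', compContinuousLinearMap_apply]
    congr 1
    funext i
    refine Fin.cases ?_ (fun i => ?_) i
    · simp [radialFlowCLM_apply]
    · simp
  have h1 := happ (splitArgs hq b v)
  rw [hΩ] at h1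
  refine Eq.trans ?_ h1.symm
  refine integral_congr_ae (Eventually.of_forall fun t => ?_)
  have h2 := map_append_comp_linearMap hq (β t)
    (fun i => (v i, (0 : Y))) b (LinearMap.inr ℝ X Y) (Real.exp t • LinearMap.id)
  rw [LinearMap.det_smul, LinearMap.det_id, mul_one, Module.finrank_eq_card_basis b,
    Fintype.card_fin] at h2
  refine h2.symm.trans ?_
  simp only [β', compContinuousLinearMap_apply]
  congr 1
  funext l
  simp only [splitArgs, Function.comp]
  refine Fin.addCases (fun j => ?_) (fun j => ?_)
    (Fin.cast hq l)
  · simp [radialFlowCLM_apply]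
  · simp [radialFlowCLM_apply]

/-- The integral of `α` over the fibres of `X × Y → X`, oriented by the basis `b`. -/
def prodFibreIntegral {q k : ℕ} (hq : q = k + n) (b : Module.Basis (Fin n) ℝ Y) [MeasurableSpace Y]
    (μ : Measure Y) (α : X × Y → (X × Y) [⋀^Fin q]→L[ℝ] ℝ) (x : X) : X [⋀^Fin k]→L[ℝ] ℝ :=
  ∫ y, contractLastCLM hq (ContinuousLinearMap.inl ℝ X Y) (fun i => ((0 : X), b i)) (α (x, y)) ∂μ

variable [MeasurableSpace Y] [BorelSpace Y] (μ : Measure Y) [μ.IsAddHaarMeasure]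

theorem contDiffOn_prodFibreIntegral {q k : ℕ} (hq : q = k + n) (b : Module.Basis (Fin n) ℝ Y)
    {α : X × Y → (X × Y) [⋀^Fin q]→L[ℝ] ℝ} {r : ℕ∞} {G : Set X} (hG : IsOpen G)
    {C : Set (X × Y)} (hC : IsCompact C) (hα0 : ∀ z : X × Y, z.1 ∈ G → z ∉ C → α z = 0)
    (hαs : ∀ z : X × Y, z.1 ∈ G → ContDiffAt ℝ r α z) :
    ContDiffOn ℝ r (prodFibreIntegral hq b μ α) G := by
  refine contDiffOn_integral_of_compactSupport (g := fun x y => contractLastCLM hq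
    (ContinuousLinearMap.inl ℝ X Y) (fun i => ((0 : X), b i)) (α (x, y))) hG
    (hC.image continuous_snd) (fun x y hx hy => ?_) ?_
  · rw [hα0 (x, y) hx fun h => hy ⟨_, h, rfl⟩, _root_.map_zero]
  · intro z hz
    exact ((contractLastCLM hq (ContinuousLinearMap.inl ℝ X Y)
      (fun i => ((0 : X), b i))).contDiff.contDiffAt.comp z (hαs z hz.1)).contDiffWithinAt

/-- Polar coordinates contribute r^(n-1) and the substitution r = e^t another e^t; the total weight
e^(nt) is exactly the one in `integral_ray_eq_zero`. -/
theorem integral_splitArgs_extDeriv_eq_zero (hn : 0 < n) {k : ℕ} (hq : k + 1 + 1 = m + 1 + n)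
    (hX : Module.finrank ℝ X = m + 1) (b : Module.Basis (Fin n) ℝ Y)
    {O : Set (X × Y)} (hO : IsOpen O) (hOt : ∀ z ∈ O, ∀ t : ℝ, radialFlow (t, z) ∈ O)
    (hO0 : ∀ z ∈ O, z.2 ≠ 0)
    {θ : X × Y → (X × Y) [⋀^Fin k]→L[ℝ] ℝ} (hθ : ∀ z ∈ O, ContDiffAt ℝ 1 θ z)
    (hd : ∀ z ∈ O, extDeriv θ z = 0)
    (hR : ∀ z ∈ O, ∀ v : Fin k → X × Y, (∃ i, v i = (0, z.2)) → θ z v = 0)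
    {χ : X × Y → (X × Y) [⋀^Fin 1]→L[ℝ] ℝ}
    (hχ : ∀ z ∈ O, ∫ t : ℝ, χ (radialFlow (t, z)) (fun _ => (0, (radialFlow (t, z)).2)) = 1)
    {α : X × Y → (X × Y) [⋀^Fin (k + 1)]→L[ℝ] ℝ} (hα : ∀ z ∈ O, α z = wedgeOneForm (χ z) (θ z))
    {G : Set X} (hG : IsOpen G) {C : Set (X × Y)} (hC : IsCompact C) (hCO : C ⊆ O)
    (hα0 : ∀ z : X × Y, z.1 ∈ G → z ∉ C → α z = 0) (hαs : ∀ z : X × Y, z.1 ∈ G → ContDiffAt ℝ 1 α z)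
    {x : X} (hx : x ∈ G) (v : Fin (m + 1) → X) :
    ∫ y, extDeriv α (x, y) (splitArgs hq b v) ∂μ = 0 := by
  have hfY : Module.finrank ℝ Y = n := by
    rw [Module.finrank_eq_card_basis b, Fintype.card_fin]
  have : Nontrivial Y := Module.nontrivial_of_finrank_pos (R := ℝ) (by omega)
  refine integral_eq_zero_of_integral_ray_eq_zero μ fun y hy => ?_
  rw [integral_Ioi_zero_eq_integral_exp, hfY]
  have hexp : ∀ t : ℝ, Real.exp t • (Real.exp t ^ (n - 1) *
      extDeriv α (x, Real.exp t • y) (splitArgs hq b v)) =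
      Real.exp t ^ n * extDeriv α (x, Real.exp t • y) (splitArgs hq b v) := by
    intro t
    rw [smul_eq_mul, ← mul_assoc, ← pow_succ', Nat.sub_add_cancel hn]
  simp only [hexp]
  have hd0 : ∀ z : X × Y, z.1 ∈ G → z ∉ C → extDeriv α z = 0 := fun z hz hzC =>
    extDeriv_eq_zero_of_notMem_compact hG hC hα0 hz hzC
  by_cases hz : (x, y) ∈ O
  · obtain ⟨K, hK, hKC⟩ := exists_compact_times (δ := ‖y‖ / 2) (D := 2 * ‖y‖) hC
      (fun z hz => hO0 z (hCO hz)) (by have := norm_pos_iff.2 hy; positivity)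
    have hy0 := norm_pos_iff.2 hy
    refine integral_ray_eq_zero hq hX b (β := fun t => extDeriv α (x, Real.exp t • y)) ?_ hK
      (fun t ht => ?_) hy (fun w => ?_) v
    · have h1 : ContinuousOn (extDeriv α) (G ×ˢ univ) := continuousOn_extDeriv
        (hG.prod isOpen_univ) fun z hz => (hαs z hz.1).contDiffWithinAt
      exact h1.comp_continuous (by fun_prop) fun t => ⟨hx, mem_univ _⟩
    · exact hd0 _ hx (hKC (x, y) (by simp only; linarith) (by simp only; linarith) t ht)
    · exact integral_extDeriv_radialFlow_eq_zero hO hOt hO0 hθ hd hR hχ hα hG hC hCO hα0 hαs hz hx w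
  -- O is invariant under the flow in both time directions, so a ray through a point off O never
  -- meets C ⊆ O, outside which dα vanishes.
  · refine integral_eq_zero_of_ae (Eventually.of_forall fun t => ?_)
    have : (x, Real.exp t • y) ∉ C := by
      intro hmem
      have h1 := hOt _ (hCO hmem) (-t)
      simp only [radialFlow, smul_smul, ← Real.exp_add, neg_add_cancel, Real.exp_zero,
        one_smul] at h1
      exact hz h1
    simp [hd0 (x, Real.exp t • y) hx this]

/-- The fibre integral of `χ ∧ θ` is closed. -/
theorem extDeriv_prodFibreIntegral_eq_zero (hn : 0 < n) {k : ℕ} (hq : k + 1 = m + n)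
    (hX : Module.finrank ℝ X = m + 1) (b : Module.Basis (Fin n) ℝ Y)
    {O : Set (X × Y)} (hO : IsOpen O) (hOt : ∀ z ∈ O, ∀ t : ℝ, radialFlow (t, z) ∈ O)
    (hO0 : ∀ z ∈ O, z.2 ≠ 0)
    {θ : X × Y → (X × Y) [⋀^Fin k]→L[ℝ] ℝ} (hθ : ∀ z ∈ O, ContDiffAt ℝ 1 θ z)
    (hd : ∀ z ∈ O, extDeriv θ z = 0)
    (hR : ∀ z ∈ O, ∀ v : Fin k → X × Y, (∃ i, v i = (0, z.2)) → θ z v = 0)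
    {χ : X × Y → (X × Y) [⋀^Fin 1]→L[ℝ] ℝ}
    (hχ : ∀ z ∈ O, ∫ t : ℝ, χ (radialFlow (t, z)) (fun _ => (0, (radialFlow (t, z)).2)) = 1)
    {α : X × Y → (X × Y) [⋀^Fin (k + 1)]→L[ℝ] ℝ} (hα : ∀ z ∈ O, α z = wedgeOneForm (χ z) (θ z))
    {G : Set X} (hG : IsOpen G) {C : Set (X × Y)} (hC : IsCompact C) (hCO : C ⊆ O)
    (hα0 : ∀ z : X × Y, z.1 ∈ G → z ∉ C → α z = 0) (hαs : ∀ z : X × Y, z.1 ∈ G → ContDiffAt ℝ 1 α z)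
    {x : X} (hx : x ∈ G) : extDeriv (prodFibreIntegral hq b μ α) x = 0 := by
  have hq' : k + 1 + 1 = m + 1 + n := by omega
  have := finiteDimensional_continuousAlternatingMap (V := X) m
  have hαO : ContDiffOn ℝ 1 α (G ×ˢ univ) := fun z hz => (hαs z hz.1).contDiffWithinAt
  have hfα : Continuous fun y => fderiv ℝ α (x, y) :=
    (hαO.continuousOn_fderiv_of_isOpen (hG.prod isOpen_univ) le_rfl).comp_continuous
      (by fun_prop) fun y => ⟨hx, mem_univ _⟩
  have hKs : IsCompact (Prod.snd '' C) := hC.image continuous_snd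
  have hf0 : ∀ y, y ∉ Prod.snd '' C → fderiv ℝ α (x, y) = 0 := by
    intro y hy
    have : α =ᶠ[𝓝 (x, y)] fun _ => 0 := by
      filter_upwards [(hG.preimage continuous_fst).mem_nhds (show (x, y).1 ∈ G from hx),
        hC.isClosed.isOpen_compl.mem_nhds (show (x, y) ∈ Cᶜ from fun h => hy ⟨_, h, rfl⟩)]
        with z' h1 h2 using hα0 z' h1 h2
    rw [this.fderiv_eq]
    simp
  have hI : ∀ u V, Integrable (fun y => fderiv ℝ α (x, y) u V) μ := by
    intro u V
    refine integrable_of_compactSupport hKs (fun y hy => by simp [hf0 y hy]) ?_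
    exact (ContinuousAlternatingMap.apply ℝ (X × Y) ℝ V).continuous.comp
      (hfα.clm_apply continuous_const)
  have hder : ∀ (u : X) (V : Fin m → X), fderiv ℝ (prodFibreIntegral hq b μ α) x u V =
      ∫ y, fderiv ℝ α (x, y) (u, 0) (splitArgs hq b V) ∂μ := by
    intro u V
    have h1 := fderiv_integral_of_compactSupport (μ := μ) (g := fun x y => contractLastCLM hq
      (ContinuousLinearMap.inl ℝ X Y) (fun i => ((0 : X), b i)) (α (x, y))) hG hKs
      (fun x y hx hy => by rw [hα0 (x, y) hx fun h => hy ⟨_, h, rfl⟩, _root_.map_zero])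
      (fun z hz => ((contractLastCLM hq (ContinuousLinearMap.inl ℝ X Y)
        (fun i => ((0 : X), b i))).contDiff.contDiffAt.comp z (hαs z hz.1)).contDiffWithinAt) hx u
    have h2 : ∀ y, fderiv ℝ (Function.uncurry fun x y => contractLastCLM hq
        (ContinuousLinearMap.inl ℝ X Y) (fun i => ((0 : X), b i)) (α (x, y))) (x, y) (u, 0) =
        contractLastCLM hq (ContinuousLinearMap.inl ℝ X Y) (fun i => ((0 : X), b i))
          (fderiv ℝ α (x, y) (u, 0)) := by
      intro y
      have h3 := (contractLastCLM hq (ContinuousLinearMap.inl ℝ X Y)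
        (fun i => ((0 : X), b i))).hasFDerivAt.comp (x, y)
        ((hαs (x, y) hx).differentiableAt one_ne_zero).hasFDerivAt
      have h4 : fderiv ℝ (Function.uncurry fun x y => contractLastCLM hq
        (ContinuousLinearMap.inl ℝ X Y) (fun i => ((0 : X), b i)) (α (x, y))) (x, y) = _ :=
        h3.fderiv
      rw [h4]
      rfl
    simp only [h2] at h1
    have hI' : Integrable (fun y => contractLastCLM hq (ContinuousLinearMap.inl ℝ X Y)
        (fun i => ((0 : X), b i)) (fderiv ℝ α (x, y) (u, 0))) μ := by
      refine integrable_of_compactSupport hKs (fun y hy => by simp [hf0 y hy]) ?_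
      exact (ContinuousLinearMap.continuous _).comp (hfα.clm_apply continuous_const)
    have h5 := ((ContinuousAlternatingMap.apply ℝ X ℝ V).integral_comp_comm hI').symm
    have h6 : fderiv ℝ (prodFibreIntegral hq b μ α) x u = _ := h1
    rw [h6]
    exact h5
  -- Vertical derivatives are total derivatives along the fibre, and the support in the fibre is
  -- compact.
  have hvert : ∀ (j : Fin n) (V : Fin (k + 1) → X × Y),
      ∫ y, fderiv ℝ α (x, y) ((0 : X), b j) V ∂μ = 0 := by
    intro j V
    have h1 := integral_fderiv_eq_zero_of_compactSupport (μ := μ) (f := fun y => α (x, y) V) hKs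
      (fun y hy => by rw [hα0 (x, y) hx fun h => hy ⟨_, h, rfl⟩]; rfl)
      (contDiff_iff_contDiffAt.2 fun y => ((hαs (x, y) hx).continuousAlternatingMap_apply_const
        V).comp (f := fun y : Y => (x, y)) y (by fun_prop)) (b j)
    rw [← h1]
    refine integral_congr_ae (Eventually.of_forall fun y => ?_)
    have h2 := (ContinuousAlternatingMap.apply ℝ (X × Y) ℝ V).hasFDerivAt.comp y
      (((hαs (x, y) hx).differentiableAt one_ne_zero).hasFDerivAt.comp (f := fun y : Y => (x, y)) y
      ((hasFDerivAt_const x y).prodMk (hasFDerivAt_id y)))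
    have h3 : fderiv ℝ (fun y => α (x, y) V) y = _ := h2.fderiv
    simp only [h3]
    rfl
  ext v
  have h0 := integral_splitArgs_extDeriv_eq_zero μ hn hq' hX b hO hOt hO0 hθ hd hR hχ hα hG hC hCO
    hα0 hαs hx v
  -- After integration only the horizontal terms survive, and they assemble into d of the fibre
  -- integral.
  have hsum : ∀ y, extDeriv α (x, y) (splitArgs hq' b v) =
      ∑ i : Fin (m + 1), (-1 : ℝ) ^ (i : ℕ) *
          fderiv ℝ α (x, y) (v i, 0) (splitArgs hq b (i.removeNth v)) +
        ∑ j : Fin n, (-1 : ℝ) ^ (m + 1 + j : ℕ) *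
          fderiv ℝ α (x, y) (0, b j) ((Fin.cast hq'.symm (Fin.natAdd (m + 1) j)).removeNth
            (splitArgs hq' b v)) := fun y =>
    alternatizeUncurryFin_append hq hq' (fderiv ℝ α (x, y)) (fun i => (v i, (0 : Y))) _
  simp only [hsum] at h0
  rw [integral_add (integrable_finsetSum _ fun i _ => (hI _ _).const_mul _)
    (integrable_finsetSum _ fun i _ => (hI _ _).const_mul _),
    integral_finsetSum _ fun i _ => (hI _ _).const_mul _,
    integral_finsetSum _ fun i _ => (hI _ _).const_mul _] at h0
  simp only [integral_const_mul, hvert, mul_zero, Finset.sum_const_zero, add_zero] at h0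
  rw [extDeriv, alternatizeUncurryFin_apply]
  simp only [hder]
  simpa using h0

end FibreIntegral

/-! ### Independence of smoothness and of d from the chart -/

section FormsInCharts

variable {E H N : Type*} [NormedAddCommGroup E] [NormedSpace ℝ E] [TopologicalSpace H]
  {I : ModelWithCorners ℝ E H} [TopologicalSpace N] [ChartedSpace H N] [IsManifold I ∞ N]
  [I.Boundaryless]

theorem mdifferentiableAt_extChartAt_symm {x : N} {y : E} (hy : y ∈ (extChartAt I x).target) :
    MDifferentiableAt 𝓘(ℝ, E) I (extChartAt I x).symm y := by
  have : IsManifold I 1 N := .of_le (n := ∞) (by simp)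
  have h := mdifferentiableWithinAt_extChartAt_symm (I := I) hy
  rwa [I.range_eq_univ, mdifferentiableWithinAt_univ] at h

theorem contDiffAt_extChartAt_comp_symm {x u : N} {y : E} (hy : y ∈ (extChartAt I x).target)
    (hu : (extChartAt I x).symm y ∈ (extChartAt I u).source) :
    ContDiffAt ℝ ∞ (extChartAt I u ∘ (extChartAt I x).symm) y := by
  have h := contDiffWithinAt_ext_coord_change (I := I) (n := ∞) u x
    (y := y) (by rw [PartialEquiv.trans_source]; exact ⟨hy, hu⟩)
  rwa [I.range_eq_univ, contDiffWithinAt_univ] at h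

/-- Transformation of the expression of a form under a change of charts. -/
theorem DiffForm.inChart_eventuallyEq {k : ℕ} (α : DiffForm I N k) {x u : N} {y : E}
    (hy : y ∈ (extChartAt I x).target)
    (hu : (extChartAt I x).symm y ∈ (extChartAt I u).source) :
    α.inChart x =ᶠ[𝓝 y] fun y' =>
      (α.inChart u ((extChartAt I u ∘ (extChartAt I x).symm) y')).compContinuousLinearMap
      (fderiv ℝ (extChartAt I u ∘ (extChartAt I x).symm) y') := by
  have : IsManifold I 1 N := .of_le (n := ∞) (by simp)
  have hopen : IsOpen ((extChartAt I x).target ∩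
      (extChartAt I x).symm ⁻¹' (extChartAt I u).source) :=
    (continuousOn_extChartAt_symm x).isOpen_inter_preimage (isOpen_extChartAt_target x)
      (isOpen_extChartAt_source u)
  filter_upwards [hopen.mem_nhds ⟨hy, hu⟩] with y' hy'
  have hu' : (extChartAt I x).symm y' ∈ (extChartAt I u).source := hy'.2
  have h1 : (extChartAt I u).symm ((extChartAt I u ∘ (extChartAt I x).symm) y') =
      (extChartAt I x).symm y' := (extChartAt I u).left_inv hu'
  have hτ : MDifferentiableAt 𝓘(ℝ, E) 𝓘(ℝ, E) (extChartAt I u ∘ (extChartAt I x).symm) y' :=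
    ((contDiffAt_extChartAt_comp_symm hy'.1 hu').differentiableAt (by simp)).mdifferentiableAt
  have hs : MDifferentiableAt 𝓘(ℝ, E) I (extChartAt I u).symm
      ((extChartAt I u ∘ (extChartAt I x).symm) y') :=
    mdifferentiableAt_extChartAt_symm ((extChartAt I u).map_source hu')
  have hev : (extChartAt I x).symm =ᶠ[𝓝 y']
      (extChartAt I u).symm ∘ (extChartAt I u ∘ (extChartAt I x).symm) := by
    filter_upwards [hopen.mem_nhds hy'] with y'' hy''
    exact ((extChartAt I u).left_inv hy''.2).symm
  have h2 : mfderiv 𝓘(ℝ, E) I (extChartAt I x).symm y' =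
      (mfderiv 𝓘(ℝ, E) I (extChartAt I u).symm ((extChartAt I u ∘ (extChartAt I x).symm) y')).comp
        (fderiv ℝ (extChartAt I u ∘ (extChartAt I x).symm) y') := by
    rw [hev.mfderiv_eq, mfderiv_comp y' hs hτ, mfderiv_eq_fderiv]
    rfl
  ext v
  simp only [DiffForm.inChart, ContinuousAlternatingMap.compContinuousLinearMap_apply]
  rw [h2]
  have h3 : ∀ (a b : N) (hab : a = b) (w : Fin k → E), (α a : E [⋀^Fin k]→L[ℝ] ℝ) w = α b w := by
    intro a b hab w; subst hab; rfl
  exact (h3 _ _ h1 _).symm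

variable [FiniteDimensional ℝ E]

/-- `DiffForm.SmoothOn` tests each point only in its own preferred chart; pulling back by the smooth
transition map gives smoothness in any other chart. -/
theorem DiffForm.SmoothOn.contDiffAt_inChart {k : ℕ} {α : DiffForm I N k} {s : Set N}
    (hα : α.SmoothOn s) {x : N} {y : E} (hy : y ∈ (extChartAt I x).target)
    (hs : (extChartAt I x).symm y ∈ s) : ContDiffAt ℝ ∞ (α.inChart x) y := by
  have hu := mem_extChartAt_source (I := I) ((extChartAt I x).symm y)
  refine ContDiffAt.congr_of_eventuallyEq ?_ (α.inChart_eventuallyEq hy hu)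
  have hτ := contDiffAt_extChartAt_comp_symm hy hu
  refine ContDiffAt.continuousAlternatingMap_compContinuousLinearMap ?_
    (hτ.fderiv_right (m := ∞) (by simp))
  exact (hα _ hs).comp y hτ

theorem DiffForm.SmoothOn.extDeriv_inChart_eq_zero {k : ℕ} {α : DiffForm I N k} {s : Set N}
    (hα : α.SmoothOn s) {x : N} {y : E} (hy : y ∈ (extChartAt I x).target)
    (hs : (extChartAt I x).symm y ∈ s) (hd : α.d ((extChartAt I x).symm y) = 0) :
    extDeriv (α.inChart x) y = 0 := by
  have : IsManifold I 1 N := .of_le (n := ∞) (by simp)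
  have hu := mem_extChartAt_source (I := I) ((extChartAt I x).symm y)
  have hτ := contDiffAt_extChartAt_comp_symm hy hu
  have h0 : DifferentiableAt ℝ (α.inChart ((extChartAt I x).symm y))
      ((extChartAt I ((extChartAt I x).symm y) ∘ (extChartAt I x).symm) y) :=
    (hα _ hs).differentiableAt (by simp)
  rw [(α.inChart_eventuallyEq hy hu).extDeriv_eq, extDeriv_pullback h0 hτ
    (by
      rw [minSmoothness_of_isRCLikeNormedField]
      exact WithTop.coe_le_coe.2 (le_top : (2 : ℕ∞) ≤ ⊤))]
  have h1 : extDeriv (α.inChart ((extChartAt I x).symm y))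
      (extChartAt I ((extChartAt I x).symm y) ((extChartAt I x).symm y)) = 0 := by
    have h2 := hd
    -- The preferred chart has identity derivative at its own base point, so here `DiffForm.d` is
    -- the exterior derivative of the local expression itself.
    rw [DiffForm.d, mfderiv_extChartAt_self] at h2
    exact h2
  simp only [Function.comp]
  rw [h1]
  rfl

end FormsInCharts

/-! ### Charts of TM: vertical vectors and lifts -/

section TangentChart

variable {n : ℕ} {M : Type*} [TopologicalSpace M] [ChartedSpace (EuclideanSpace ℝ (Fin n)) M]
  [IsManifold (𝓡 n) ∞ M]

local notation "𝔼" => EuclideanSpace ℝ (Fin n)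

variable (n) in
/-- The chart of `TM` over the preferred chart of `M` around `p`. -/
abbrev tangentChart (p : M) : PartialEquiv (TangentBundle (𝓡 n) M) (𝔼 × 𝔼) :=
  extChartAt (𝓡 n).tangent (⟨p, (0 : 𝔼)⟩ : TangentBundle (𝓡 n) M)

variable (n) in
/-- The change of coordinates in `T_q M` from the preferred chart around `q` to that around `p`. -/
abbrev fibreCoord (p q : M) : 𝔼 →L[ℝ] 𝔼 := tangentCoordChange (𝓡 n) q p q

theorem tangentChart_apply (p : M) (u : TangentBundle (𝓡 n) M) :
    tangentChart n p u = (extChartAt (𝓡 n) p u.proj, fibreCoord n p u.proj u.2) := rfl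

theorem tangentChart_symm_apply (p : M) (z : 𝔼 × 𝔼) :
    (tangentChart n p).symm z = ⟨(extChartAt (𝓡 n) p).symm z.1,
      tangentCoordChange (𝓡 n) p ((extChartAt (𝓡 n) p).symm z.1)
        ((extChartAt (𝓡 n) p).symm z.1) z.2⟩ := rfl

theorem mem_tangentChart_target {p : M} {z : 𝔼 × 𝔼} :
    z ∈ (tangentChart n p).target ↔ z.1 ∈ (extChartAt (𝓡 n) p).target := by
  rw [tangentChart, FiberBundle.extChartAt_target]
  simpa using fun h => (chartAt 𝔼 p).map_target h

theorem mem_tangentChart_source {p : M} {u : TangentBundle (𝓡 n) M} :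
    u ∈ (tangentChart n p).source ↔ u.proj ∈ (extChartAt (𝓡 n) p).source := by
  simp

theorem fibreCoord_symm_apply {p q : M} (hq : q ∈ (extChartAt (𝓡 n) p).source) (e : 𝔼) :
    tangentCoordChange (𝓡 n) p q q (fibreCoord n p q e) = e := by
  have : IsManifold (𝓡 n) 1 M := .of_le (n := ∞) (by simp)
  rw [fibreCoord, tangentCoordChange_comp ⟨⟨mem_extChartAt_source q, hq⟩, mem_extChartAt_source q⟩,
    tangentCoordChange_self (mem_extChartAt_source q)]

theorem fibreCoord_apply_symm {p q : M} (hq : q ∈ (extChartAt (𝓡 n) p).source) (e : 𝔼) :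
    fibreCoord n p q (tangentCoordChange (𝓡 n) p q q e) = e := by
  have : IsManifold (𝓡 n) 1 M := .of_le (n := ∞) (by simp)
  rw [fibreCoord, tangentCoordChange_comp ⟨⟨hq, mem_extChartAt_source q⟩, hq⟩,
    tangentCoordChange_self hq]

theorem tangentChart_symm_fibreCoord {p q : M} (hq : q ∈ (extChartAt (𝓡 n) p).source) (y : 𝔼) :
    (tangentChart n p).symm (extChartAt (𝓡 n) p q, fibreCoord n p q y) = fibreIncl q y := by
  have h : fibreIncl q y ∈ (tangentChart n p).source := mem_tangentChart_source.2 hq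
  have h1 := (tangentChart n p).left_inv h
  rwa [tangentChart_apply] at h1

/-- In the chart, the inclusion of the fibre over q is y ↦ (x, T y) with x constant and T linear. -/
theorem verticalLift_eq_mfderiv_symm {p q : M} (hq : q ∈ (extChartAt (𝓡 n) p).source) (y e : 𝔼) :
    verticalLift (fibreIncl q y) e =
      mfderiv 𝓘(ℝ, 𝔼 × 𝔼) (𝓡 n).tangent (tangentChart n p).symm
        (extChartAt (𝓡 n) p q, fibreCoord n p q y) ((0 : 𝔼), fibreCoord n p q e) := by
  have hy : (extChartAt (𝓡 n) p q, fibreCoord n p q y) ∈ (tangentChart n p).target :=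
    mem_tangentChart_target.2 ((extChartAt (𝓡 n) p).map_source hq)
  have h1 : fibreIncl (M := M) q = (tangentChart n p).symm ∘
      fun y : 𝔼 => (extChartAt (𝓡 n) p q, fibreCoord n p q y) := by
    funext y
    exact (tangentChart_symm_fibreCoord hq y).symm
  have h2 : HasFDerivAt (fun y : 𝔼 => (extChartAt (𝓡 n) p q, fibreCoord n p q y))
      ((0 : 𝔼 →L[ℝ] 𝔼).prod (fibreCoord n p q)) y :=
    (hasFDerivAt_const _ _).prodMk (fibreCoord n p q).hasFDerivAt
  have h3 := (mdifferentiableAt_extChartAt_symm hy).hasMFDerivAt.comp y h2.hasMFDerivAt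
  have h4 : verticalLift (fibreIncl q y) e =
      mfderiv 𝓘(ℝ, 𝔼) (𝓡 n).tangent (fibreIncl (M := M) q) y e := rfl
  rw [h4, h1, h3.mfderiv]
  rfl

/-- In these charts the projection of TM is `Prod.fst`; the chain rule is applied to the two
factorisations of the same map. -/
theorem mfderiv_proj_mfderiv_symm {p : M} {z : 𝔼 × 𝔼} (hz : z.1 ∈ (extChartAt (𝓡 n) p).target)
    (v : 𝔼 × 𝔼) :
    mfderiv (𝓡 n).tangent (𝓡 n) (fun w : TangentBundle (𝓡 n) M => w.proj)
      ((tangentChart n p).symm z)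
      (mfderiv 𝓘(ℝ, 𝔼 × 𝔼) (𝓡 n).tangent (tangentChart n p).symm z v) =
    mfderiv 𝓘(ℝ, 𝔼) (𝓡 n) (extChartAt (𝓡 n) p).symm z.1 v.1 := by
  have h1 : MDifferentiableAt (𝓡 n).tangent (𝓡 n) (fun w : TangentBundle (𝓡 n) M => w.proj)
      ((tangentChart n p).symm z) :=
    (contMDiffAt_proj (n := 1) (TangentSpace (𝓡 n))).mdifferentiableAt one_ne_zero
  have h2 := h1.hasMFDerivAt.comp z
    (mdifferentiableAt_extChartAt_symm (mem_tangentChart_target.2 hz)).hasMFDerivAt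
  have h3 : HasFDerivAt (Prod.fst : 𝔼 × 𝔼 → 𝔼) (ContinuousLinearMap.fst ℝ 𝔼 𝔼) z := hasFDerivAt_fst
  have h4 := (mdifferentiableAt_extChartAt_symm (I := 𝓡 n) hz).hasMFDerivAt.comp z h3.hasMFDerivAt
  have h5 := hasMFDerivAt_unique h2 h4
  exact DFunLike.congr_fun h5 v

theorem isInvertible_mfderiv_extChartAt_symm {E H N : Type*} [NormedAddCommGroup E]
    [NormedSpace ℝ E] [TopologicalSpace H] {I : ModelWithCorners ℝ E H} [TopologicalSpace N]
    [ChartedSpace H N] [IsManifold I ∞ N] [I.Boundaryless] {x : N} {y : E}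
    (hy : y ∈ (extChartAt I x).target) :
    (mfderiv 𝓘(ℝ, E) I (extChartAt I x).symm y).IsInvertible := by
  have : IsManifold I 1 N := .of_le (n := ∞) (by simp)
  have h := isInvertible_mfderivWithin_extChartAt_symm (I := I) hy
  rwa [I.range_eq_univ, mfderivWithin_univ] at h

/-- A tangent vector of `TM` over `v` is a lift of `v`. -/
theorem exists_eq_mfderiv_symm {p : M} {z : 𝔼 × 𝔼} (hz : z.1 ∈ (extChartAt (𝓡 n) p).target)
    (ξ : TangentSpace (𝓡 n).tangent ((tangentChart n p).symm z)) (v : 𝔼)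
    (h : mfderiv (𝓡 n).tangent (𝓡 n) (fun w : TangentBundle (𝓡 n) M => w.proj)
      ((tangentChart n p).symm z) ξ = mfderiv 𝓘(ℝ, 𝔼) (𝓡 n) (extChartAt (𝓡 n) p).symm z.1 v) :
    ∃ c : 𝔼, ξ = mfderiv 𝓘(ℝ, 𝔼 × 𝔼) (𝓡 n).tangent (tangentChart n p).symm z (v, c) := by
  obtain ⟨w, hw⟩ := (isInvertible_mfderiv_extChartAt_symm (I := (𝓡 n).tangent)
    (mem_tangentChart_target.2 hz)).bijective.2 ξ
  refine ⟨w.2, ?_⟩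
  have h1 := mfderiv_proj_mfderiv_symm hz w
  have h2 : w.1 = v := by
    apply (isInvertible_mfderiv_extChartAt_symm (I := 𝓡 n) hz).injective
    rw [← h, ← hw]
    exact h1.symm
  rw [← h2]
  exact hw.symm

end TangentChart

/-! ### The cone U, the radial field and the support form in a chart -/

section ConicChart

variable {n : ℕ} {M : Type*} [TopologicalSpace M] [ChartedSpace (EuclideanSpace ℝ (Fin n)) M]
  [IsManifold (𝓡 n) ∞ M]

local notation "𝔼" => EuclideanSpace ℝ (Fin n)

/-- The set `U ⊆ TM` in the chart of `TM` over the preferred chart around `p`. -/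
def chartPreimage (p : M) (U : Set (TangentBundle (𝓡 n) M)) : Set (𝔼 × 𝔼) :=
  (tangentChart n p).target ∩ (tangentChart n p).symm ⁻¹' U

variable {U : Set (TangentBundle (𝓡 n) M)} {p : M}

theorem isOpen_chartPreimage (hU : IsOpen U) : IsOpen (chartPreimage p U) :=
  (continuousOn_extChartAt_symm _).isOpen_inter_preimage (isOpen_extChartAt_target _) hU

theorem fst_mem_of_mem_chartPreimage {z : 𝔼 × 𝔼} (hz : z ∈ chartPreimage p U) :
    z.1 ∈ (extChartAt (𝓡 n) p).target := mem_tangentChart_target.1 hz.1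

theorem mem_chartPreimage_iff {q : M} (hq : q ∈ (extChartAt (𝓡 n) p).source) (y : 𝔼) :
    (extChartAt (𝓡 n) p q, fibreCoord n p q y) ∈ chartPreimage p U ↔ fibreIncl q y ∈ U := by
  rw [chartPreimage, mem_inter_iff, mem_preimage, tangentChart_symm_fibreCoord hq]
  exact and_iff_right (mem_tangentChart_target.2 ((extChartAt (𝓡 n) p).map_source hq))

theorem radialFlow_mem_chartPreimage (hU : IsConicSubbundle U) {z : 𝔼 × 𝔼}
    (hz : z ∈ chartPreimage p U) (t : ℝ) : radialFlow (t, z) ∈ chartPreimage p U := by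
  refine ⟨mem_tangentChart_target.2 (show z.1 ∈ _ from fst_mem_of_mem_chartPreimage hz), ?_⟩
  have h1 := hU.smul_mem _ hz.2 (Real.exp t) (Real.exp_pos t).ne'
  have h2 : (tangentChart n p).symm (radialFlow (t, z)) =
      ⟨((tangentChart n p).symm z).proj, Real.exp t • ((tangentChart n p).symm z).2⟩ := by
    rw [tangentChart_symm_apply, tangentChart_symm_apply]
    simp only [radialFlow, map_smul]
    rfl
  rw [mem_preimage, h2]
  exact h1

theorem snd_ne_zero_of_mem_chartPreimage (hU : IsConicSubbundle U) {z : 𝔼 × 𝔼}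
    (hz : z ∈ chartPreimage p U) : z.2 ≠ 0 := by
  intro h
  have h1 := hU.ne_zero _ hz.2
  rw [tangentChart_symm_apply, h] at h1
  exact h1 (map_zero _)

theorem mfderiv_symm_vertical {z : 𝔼 × 𝔼} (hz : z.1 ∈ (extChartAt (𝓡 n) p).target) (e : 𝔼) :
    mfderiv 𝓘(ℝ, 𝔼 × 𝔼) (𝓡 n).tangent (tangentChart n p).symm z ((0 : 𝔼), e) =
      verticalLift ((tangentChart n p).symm z) (tangentCoordChange (𝓡 n) p
        ((extChartAt (𝓡 n) p).symm z.1) ((extChartAt (𝓡 n) p).symm z.1) e) := by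
  have hq := (extChartAt (𝓡 n) p).map_target hz
  have h1 := verticalLift_eq_mfderiv_symm hq (tangentCoordChange (𝓡 n) p
        ((extChartAt (𝓡 n) p).symm z.1) ((extChartAt (𝓡 n) p).symm z.1) z.2)
        (tangentCoordChange (𝓡 n) p
        ((extChartAt (𝓡 n) p).symm z.1) ((extChartAt (𝓡 n) p).symm z.1) e)
  rw [fibreCoord_apply_symm hq, fibreCoord_apply_symm hq, (extChartAt (𝓡 n) p).right_inv hz] at h1
  exact h1.symm

theorem mfderiv_symm_radial {z : 𝔼 × 𝔼} (hz : z.1 ∈ (extChartAt (𝓡 n) p).target) :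
    mfderiv 𝓘(ℝ, 𝔼 × 𝔼) (𝓡 n).tangent (tangentChart n p).symm z ((0 : 𝔼), z.2) =
      radialField ((tangentChart n p).symm z) :=
  mfderiv_symm_vertical hz z.2

/-- In coordinates the field is the linear expression (0, z.2). Its smoothness makes it admissible
in the null condition, which then yields i_ℛ θ = 0. -/
theorem smoothVectorFieldOn_radialField (U : Set (TangentBundle (𝓡 n) M)) :
    SmoothVectorFieldOn (𝓡 n).tangent (radialField (n := n) (M := M)) U := by
  intro u _
  refine ContMDiffAt.contMDiffWithinAt ?_
  rw [contMDiffAt_section]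
  -- The preferred chart of TM at u depends only on the base point of u, so `tangentChart n u.proj`
  -- is that chart.
  have h1 : ContMDiffAt (𝓡 n).tangent 𝓘(ℝ, 𝔼 × 𝔼) ∞ (tangentChart n u.proj) u :=
    contMDiffAt_extChartAt (I := (𝓡 n).tangent) (x := u)
  have h2 : ContMDiffAt (𝓡 n).tangent 𝓘(ℝ, 𝔼 × 𝔼) ∞
      (fun u' : TangentBundle (𝓡 n) M => ((0 : 𝔼), (tangentChart n u.proj u').2)) u := by
    have h3 : ContDiff ℝ ∞ (fun z : 𝔼 × 𝔼 => ((0 : 𝔼), z.2)) := contDiff_const.prodMk contDiff_snd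
    exact h3.contMDiff.contMDiffAt.comp u h1
  refine h2.congr_of_eventuallyEq ?_
  filter_upwards [(isOpen_extChartAt_source (I := (𝓡 n).tangent) u).mem_nhds
    (mem_extChartAt_source u)] with u' hu'
  have hu2 : u' ∈ (chartAt (ModelProd 𝔼 𝔼) u).source := by rwa [extChartAt_source] at hu'
  have h4 : (trivializationAt (𝔼 × 𝔼) (TangentSpace (𝓡 n).tangent) u
      (⟨u', radialField u'⟩ : TotalSpace (𝔼 × 𝔼) (TangentSpace (𝓡 n).tangent))).2 =
      (trivializationAt (𝔼 × 𝔼) (TangentSpace (𝓡 n).tangent) u).continuousLinearMapAt ℝ u'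
        (radialField u') := by
    rw [Trivialization.continuousLinearMapAt_apply, Trivialization.linearMapAt_apply, if_pos]
    exact hu2
  have hz : (tangentChart n u.proj u').1 ∈ (extChartAt (𝓡 n) u.proj).target :=
    mem_tangentChart_target.1 ((tangentChart n u.proj).map_source hu')
  have h5 := mfderiv_symm_radial hz
  have h6 : (tangentChart n u.proj).symm (tangentChart n u.proj u') = u' :=
    (tangentChart n u.proj).left_inv hu'
  have h7 := mfderiv_extChartAt_comp_mfderivWithin_extChartAt_symm (I := (𝓡 n).tangent) (x := u)
    ((tangentChart n u.proj).map_source hu')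
  rw [(𝓡 n).tangent.range_eq_univ, mfderivWithin_univ] at h7
  have h8 := DFunLike.congr_fun h7 ((0 : 𝔼), (tangentChart n u.proj u').2)
  refine h4.trans ?_
  rw [TangentBundle.continuousLinearMapAt_trivializationAt hu2]
  have h9 : mfderiv (𝓡 n).tangent 𝓘(ℝ, 𝔼 × 𝔼) (extChartAt (𝓡 n).tangent u)
      ((tangentChart n u.proj).symm (tangentChart n u.proj u'))
      (radialField ((tangentChart n u.proj).symm (tangentChart n u.proj u'))) =
      ((0 : 𝔼), (tangentChart n u.proj u').2) := by
    rw [← h5]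
    exact h8
  rw [h6] at h9
  exact h9

/-- In the chart, a form satisfying the null condition for a Vlasov bivector is annihilated by the
radial vector field. -/
theorem inChart_apply_eq_zero_of_null {Ψ : BivectorField (𝓡 n).tangent (TangentBundle (𝓡 n) M)}
    (hΨ : IsVlasovBivector U Ψ) {k : ℕ} {θ : DiffForm (𝓡 n).tangent (TangentBundle (𝓡 n) M) k}
    (hθ : NullConditionOn Ψ θ U) {z : 𝔼 × 𝔼} (hz : z ∈ chartPreimage p U) (v : Fin k → 𝔼 × 𝔼)
    (hv : ∃ i, v i = ((0 : 𝔼), z.2)) :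
    θ.inChart (⟨p, (0 : 𝔼)⟩ : TangentBundle (𝓡 n) M) z v = 0 := by
  obtain ⟨W, hW, hΨW⟩ := hΨ
  obtain ⟨i, hi⟩ := hv
  refine (hθ radialField W (smoothVectorFieldOn_radialField U) hW.smooth hΨW).1 _ hz.2 _ ⟨i, ?_⟩
  rw [← mfderiv_symm_radial (fst_mem_of_mem_chartPreimage hz), ← hi]
  rfl

/-- At e^t z the radial vector is e^t times the velocity used in `rayCoefficient`; this factor is
the Jacobian of r = e^t. -/
theorem integral_radialFlow_eq_one {χ : DiffForm (𝓡 n).tangent (TangentBundle (𝓡 n) M) 1}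
    (hχ : IsSupportForm U χ) {z : 𝔼 × 𝔼} (hz : z ∈ chartPreimage p U) :
    ∫ t : ℝ, χ.inChart (⟨p, (0 : 𝔼)⟩ : TangentBundle (𝓡 n) M) (radialFlow (t, z))
      (fun _ => ((0 : 𝔼), (radialFlow (t, z)).2)) = 1 := by
  rw [← hχ.integral_eq_one _ hz.2, integral_Ioi_zero_eq_integral_exp]
  refine integral_congr_ae (Eventually.of_forall fun t => ?_)
  have hz1 := fst_mem_of_mem_chartPreimage hz
  have hz2 : (radialFlow (t, z)).1 ∈ (extChartAt (𝓡 n) p).target := hz1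
  have h1 : (fun _ : Fin 1 => ((0 : 𝔼), (radialFlow (t, z)).2)) =
      Real.exp t • fun _ : Fin 1 => ((0 : 𝔼), z.2) := by
    funext i
    simp [radialFlow]
  have h2 : ∀ (β : (𝔼 × 𝔼) [⋀^Fin 1]→L[ℝ] ℝ) (c : ℝ) (v : Fin 1 → 𝔼 × 𝔼), β (c • v) = c • β v := by
    intro β c v
    have := β.toMultilinearMap.map_smul_univ (fun _ => c) v
    exact this.trans (by simp)
  have h3 : (tangentChart n p).symm (radialFlow (t, z)) =
      fibreIncl ((tangentChart n p).symm z).proj (Real.exp t • ((tangentChart n p).symm z).2) := by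
    rw [tangentChart_symm_apply, tangentChart_symm_apply]
    simp only [radialFlow, map_smul]
    rfl
  simp only
  rw [h1, h2]
  congr 1
  have h4 := mfderiv_symm_vertical hz2 z.2
  simp only [DiffForm.inChart, rayCoefficient]
  have h5 : (fun _ : Fin 1 => mfderiv 𝓘(ℝ, 𝔼 × 𝔼) (𝓡 n).tangent (tangentChart n p).symm
      (radialFlow (t, z)) ((0 : 𝔼), z.2)) =
      fun _ => verticalLift ((tangentChart n p).symm (radialFlow (t, z)))
        ((tangentChart n p).symm z).2 := by
    funext _
    exact h4
  have h6 : ∀ u u' : TangentBundle (𝓡 n) M, u = u' → ∀ e : 𝔼,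
      χ u (fun _ => verticalLift u e) = χ u' (fun _ => verticalLift u' e) := by
    rintro u _ rfl e
    rfl
  refine Eq.trans ?_ (h6 _ _ h3 _)
  exact congrArg _ h5

end ConicChart

/-! ### The fibre integral on M in coordinates -/

section FibreIntegralInChart

variable {n : ℕ} {M : Type*} [TopologicalSpace M] [ChartedSpace (EuclideanSpace ℝ (Fin n)) M]
  [IsManifold (𝓡 n) ∞ M]

local notation "𝔼" => EuclideanSpace ℝ (Fin n)

/-- The expression of a form on `U ⊆ TM` in the chart of `TM` over the preferred chart around `p`,
extended by zero outside `U`. -/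
def DiffForm.inTangentChart {k : ℕ} (α : DiffForm (𝓡 n).tangent (TangentBundle (𝓡 n) M) k)
    (p : M) (U : Set (TangentBundle (𝓡 n) M)) : 𝔼 × 𝔼 → (𝔼 × 𝔼) [⋀^Fin k]→L[ℝ] ℝ :=
  (chartPreimage p U).indicator (α.inChart (⟨p, (0 : 𝔼)⟩ : TangentBundle (𝓡 n) M))

/-- The integrand of the fibre integral, in the chart. -/
theorem contractLast_symm_apply {q k : ℕ} (hq : q = k + n)
    (α : DiffForm (𝓡 n).tangent (TangentBundle (𝓡 n) M) q) {p : M} {z : 𝔼 × 𝔼}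
    (hz : z.1 ∈ (extChartAt (𝓡 n) p).target) (v : Fin k → 𝔼) :
    contractLast hq (E := 𝔼) (α ((tangentChart n p).symm z))
      (sectionLift ((tangentChart n p).symm z))
      (fun i => verticalLift ((tangentChart n p).symm z) (EuclideanSpace.basisFun (Fin n) ℝ i))
      (fun j => mfderiv 𝓘(ℝ, 𝔼) (𝓡 n) (extChartAt (𝓡 n) p).symm z.1 (v j)) =
    LinearMap.det (fibreCoord n p ((extChartAt (𝓡 n) p).symm z.1) : 𝔼 →ₗ[ℝ] 𝔼) *
      contractLast hq (α.inChart (⟨p, (0 : 𝔼)⟩ : TangentBundle (𝓡 n) M) z)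
        (ContinuousLinearMap.inl ℝ 𝔼 𝔼)
        (fun i => ((0 : 𝔼), (EuclideanSpace.basisFun (Fin n) ℝ).toBasis i)) v := by
  set u := (tangentChart n p).symm z with hu
  set T := fibreCoord n p ((extChartAt (𝓡 n) p).symm z.1)
  let D : 𝔼 × 𝔼 →L[ℝ] 𝔼 × 𝔼 := mfderiv 𝓘(ℝ, 𝔼 × 𝔼) (𝓡 n).tangent (tangentChart n p).symm z
  let A : (𝔼 × 𝔼) [⋀^Fin q]→L[ℝ] ℝ := α u
  have hqs := (extChartAt (𝓡 n) p).map_target hz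
  have hbij : Function.Bijective D := (isInvertible_mfderiv_extChartAt_symm
    (I := (𝓡 n).tangent) (mem_tangentChart_target.2 hz)).bijective
  have hT : Function.Surjective T := fun e => ⟨_, fibreCoord_apply_symm hqs e⟩
  have hvert : ∀ e : 𝔼, (verticalLift u e : 𝔼 × 𝔼) = D ((0 : 𝔼), T e) := by
    intro e
    have h1 := mfderiv_symm_vertical hz (T e)
    rw [fibreCoord_symm_apply hqs] at h1
    exact h1.symm
  let b : Fin n → 𝔼 × 𝔼 := fun i => verticalLift u (EuclideanSpace.basisFun (Fin n) ℝ i)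
  have hb : b = fun i => ((D : 𝔼 × 𝔼 →ₗ[ℝ] 𝔼 × 𝔼) ∘ₗ LinearMap.inr ℝ 𝔼 𝔼) ((T : 𝔼 →ₗ[ℝ] 𝔼)
        ((EuclideanSpace.basisFun (Fin n) ℝ).toBasis i)) := by
    funext i
    refine (hvert _).trans ?_
    rw [OrthonormalBasis.coe_toBasis]
    rfl
  have hspan : Submodule.span ℝ (range b) =
      Submodule.map (((D : 𝔼 × 𝔼 →ₗ[ℝ] 𝔼 × 𝔼) ∘ₗ LinearMap.inr ℝ 𝔼 𝔼) ∘ₗ (T : 𝔼 →ₗ[ℝ] 𝔼)) ⊤ := by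
    rw [← (EuclideanSpace.basisFun (Fin n) ℝ).toBasis.span_eq, Submodule.map_span, ← range_comp, hb]
    rfl
  have hlift : ∀ j, ∃ c : 𝔼, (sectionLift u (mfderiv 𝓘(ℝ, 𝔼) (𝓡 n) (extChartAt (𝓡 n) p).symm z.1
      (v j)) : 𝔼 × 𝔼) = D (v j, c) := fun j =>
    exists_eq_mfderiv_symm hz _ _ (mfderiv_proj_sectionLift u _)
  choose c hc using hlift
  -- The lift of each v j differs from D (v j, 0) by a vertical vector, which lies in the span of
  -- the n vertical vectors already inserted.
  have h1 : A (fun l => Fin.append (fun j => (sectionLift u (mfderiv 𝓘(ℝ, 𝔼) (𝓡 n)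
      (extChartAt (𝓡 n) p).symm z.1 (v j)) : 𝔼 × 𝔼))
      b (Fin.cast hq l)) =
      A (fun l => Fin.append (fun j => D (v j, 0)) b (Fin.cast hq l)) := by
    refine map_append_eq_of_sub_mem_span hq A _ _ _ fun j => ?_
    rw [hspan, hc]
    obtain ⟨e, he⟩ := hT (c j)
    refine ⟨e, Submodule.mem_top, ?_⟩
    simp only [LinearMap.comp_apply, ContinuousLinearMap.coe_coe, he, LinearMap.inr_apply]
    rw [← map_sub]
    simp
  refine h1.trans ?_
  -- Passing from the standard frame at the point to the coordinate frame of the chart costs det T.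
  have h2 := map_append_comp_linearMap hq A (fun j => D (v j, 0))
    (EuclideanSpace.basisFun (Fin n) ℝ).toBasis ((D : 𝔼 × 𝔼 →ₗ[ℝ] 𝔼 × 𝔼) ∘ₗ LinearMap.inr ℝ 𝔼 𝔼)
    (T : 𝔼 →ₗ[ℝ] 𝔼)
  rw [hb, h2]
  congr 1
  rw [contractLast_apply]
  have h4 : (fun l => Fin.append (fun j => D (v j, 0)) (fun i => ((D : 𝔼 × 𝔼 →ₗ[ℝ] 𝔼 × 𝔼) ∘ₗ
      LinearMap.inr ℝ 𝔼 𝔼) ((EuclideanSpace.basisFun (Fin n) ℝ).toBasis i)) (Fin.cast hq l)) =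
      fun l => D (Fin.append (fun j => ContinuousLinearMap.inl ℝ 𝔼 𝔼 (v j))
        (fun i => ((0 : 𝔼), (EuclideanSpace.basisFun (Fin n) ℝ).toBasis i)) (Fin.cast hq l)) := by
    funext l
    refine Fin.addCases (fun j => ?_) (fun j => ?_) (Fin.cast hq l) <;> simp
  rw [h4]
  rfl

theorem integral_comp_eq_abs_det_inv_smul {F : Type*} [NormedAddCommGroup F] [NormedSpace ℝ F]
    {G : Type*} [NormedAddCommGroup G] [NormedSpace ℝ G] [FiniteDimensional ℝ G]
    [MeasurableSpace G] [BorelSpace G] (μ : Measure G) [μ.IsAddHaarMeasure] {T : G →L[ℝ] G}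
    (hT : LinearMap.det (T : G →ₗ[ℝ] G) ≠ 0) (f : G → F) :
    ∫ y, f (T y) ∂μ = |LinearMap.det (T : G →ₗ[ℝ] G)|⁻¹ • ∫ y, f y ∂μ := by
  let e : G ≃ₜ G := ((T : G →ₗ[ℝ] G).equivOfDetNeZero hT).toContinuousLinearEquiv.toHomeomorph
  have h := e.measurableEmbedding.integral_map (μ := μ) f
  have h1 : Measure.map e μ =
      Measure.map (T : G →ₗ[ℝ] G) μ := rfl
  rw [h1, Measure.map_linearMap_addHaar_eq_smul_addHaar μ hT, integral_smul_measure,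
    ENNReal.toReal_ofReal (abs_nonneg _), abs_inv] at h
  exact h.symm

theorem det_fibreCoord_ne_zero {p q : M} (hq : q ∈ (extChartAt (𝓡 n) p).source) :
    LinearMap.det (fibreCoord n p q : 𝔼 →ₗ[ℝ] 𝔼) ≠ 0 := by
  have h : (fibreCoord n p q : 𝔼 →ₗ[ℝ] 𝔼) ∘ₗ (tangentCoordChange (𝓡 n) p q q : 𝔼 →ₗ[ℝ] 𝔼) =
      LinearMap.id := LinearMap.ext fun e => fibreCoord_apply_symm hq e
  have h1 := congrArg LinearMap.det h
  rw [LinearMap.det_comp, LinearMap.det_id] at h1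
  exact left_ne_zero_of_mul_eq_one h1

/-- The vertical frame contributes det T and the change of variable y ↦ T y contributes |det T|⁻¹;
what remains is the sign of det T. -/
theorem fibreIntegral_inChart (o : ManifoldOrientation n M) {U : Set (TangentBundle (𝓡 n) M)}
    (hU : IsOpen U) {q k : ℕ}
    (hq : q = k + n) (α : DiffForm (𝓡 n).tangent (TangentBundle (𝓡 n) M) q) {p : M} {x : 𝔼}
    (hx : x ∈ (extChartAt (𝓡 n) p).target) :
    (fibreIntegral o U hq α).inChart p x =
      (o.sign ((extChartAt (𝓡 n) p).symm x) *
        (LinearMap.det (fibreCoord n p ((extChartAt (𝓡 n) p).symm x) : 𝔼 →ₗ[ℝ] 𝔼) *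
        |LinearMap.det (fibreCoord n p ((extChartAt (𝓡 n) p).symm x) : 𝔼 →ₗ[ℝ] 𝔼)|⁻¹)) •
      prodFibreIntegral hq (EuclideanSpace.basisFun (Fin n) ℝ).toBasis volume
        (α.inTangentChart p U) x := by
  set s := (extChartAt (𝓡 n) p).symm x with hs
  set T := fibreCoord n p s
  have hqs : s ∈ (extChartAt (𝓡 n) p).source := (extChartAt (𝓡 n) p).map_target hx
  have hxs : extChartAt (𝓡 n) p s = x := (extChartAt (𝓡 n) p).right_inv hx
  let D : 𝔼 →L[ℝ] 𝔼 := mfderiv 𝓘(ℝ, 𝔼) (𝓡 n) (extChartAt (𝓡 n) p).symm x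
  let F : TangentBundle (𝓡 n) M → 𝔼 [⋀^Fin k]→L[ℝ] ℝ := fun u =>
    contractLast hq (E := 𝔼) (α u) (sectionLift u)
      (fun i => verticalLift u (EuclideanSpace.basisFun (Fin n) ℝ i))
  let Dc : (𝔼 [⋀^Fin k]→L[ℝ] ℝ) →L[ℝ] (𝔼 [⋀^Fin k]→L[ℝ] ℝ) :=
    ContinuousAlternatingMap.compContinuousLinearMapCLM D
  let g : 𝔼 → 𝔼 [⋀^Fin k]→L[ℝ] ℝ := fun y => contractLastCLM hq (ContinuousLinearMap.inl ℝ 𝔼 𝔼)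
    (fun i => ((0 : 𝔼), (EuclideanSpace.basisFun (Fin n) ℝ).toBasis i))
    (α.inTangentChart p U (x, y))
  have := finiteDimensional_continuousAlternatingMap (V := 𝔼) k
  have hD : Function.Surjective D :=
    (isInvertible_mfderiv_extChartAt_symm (I := 𝓡 n) hx).bijective.2
  have hDc : LinearMap.ker (Dc : (𝔼 [⋀^Fin k]→L[ℝ] ℝ) →ₗ[ℝ] (𝔼 [⋀^Fin k]→L[ℝ] ℝ)) = ⊥ := by
    refine LinearMap.ker_eq_bot.2 fun A B hAB => ?_
    ext v
    choose w hw using fun j => hD (v j)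
    have h1 : A (fun j => D (w j)) = B (fun j => D (w j)) :=
      DFunLike.congr_fun (show Dc A = Dc B from hAB) w
    simpa only [hw] using h1
  -- Being injective in finite dimension, `Dc` is antilipschitz, so it commutes with the integral
  -- even where the integrand is not integrable.
  obtain ⟨K, -, hK⟩ := LinearMap.exists_antilipschitzWith _ hDc
  have hmeas : MeasurableSet {y : 𝔼 | fibreIncl s y ∈ U} := by
    have h1 : {y : 𝔼 | fibreIncl s y ∈ U} = (fun y => (extChartAt (𝓡 n) p s, T y)) ⁻¹'
        chartPreimage p U := by
      ext y
      exact (mem_chartPreimage_iff hqs y).symm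
    rw [h1]
    exact ((isOpen_chartPreimage hU).preimage (by fun_prop)).measurableSet
  have h0 : (fibreIntegral o U hq α).inChart p x =
      Dc (o.sign s • ∫ y in {y : 𝔼 | fibreIncl s y ∈ U}, F (fibreIncl s y)) := rfl
  rw [h0, map_smul, ← Dc.integral_comp_comm' hK, ← integral_indicator hmeas]
  have h1 : ({y : 𝔼 | fibreIncl s y ∈ U}.indicator fun y => Dc (F (fibreIncl s y))) =
      fun y => LinearMap.det (T : 𝔼 →ₗ[ℝ] 𝔼) • g (T y) := by
    funext y
    have hy := mem_chartPreimage_iff (U := U) hqs y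
    rw [hxs] at hy
    by_cases hyU : fibreIncl s y ∈ U
    · rw [indicator_of_mem (show y ∈ {y : 𝔼 | fibreIncl s y ∈ U} from hyU)]
      ext v
      have h2 := contractLast_symm_apply hq α (z := (x, T y)) hx v
      have h3 := tangentChart_symm_fibreCoord hqs y
      rw [hxs] at h3
      have h4 : (Dc (F ((tangentChart n p).symm (x, T y)))) v = _ := h2
      rw [h3] at h4
      have h5 : α.inTangentChart p U (x, T y) = α.inChart (⟨p, (0 : 𝔼)⟩ : TangentBundle (𝓡 n) M)
        (x, T y) := indicator_of_mem (hy.2 hyU) _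
      have h6 : g (T y) = contractLast hq (α.inTangentChart p U (x, T y)) _ _ := rfl
      rw [h4, h6, h5]
      rfl
    · rw [indicator_of_notMem (show y ∉ {y : 𝔼 | fibreIncl s y ∈ U} from hyU)]
      have h5 : α.inTangentChart p U (x, T y) = 0 := indicator_of_notMem (mt hy.1 hyU) _
      simp only [g, h5, _root_.map_zero, smul_zero]
  rw [h1, integral_smul, integral_comp_eq_abs_det_inv_smul _ (det_fibreCoord_ne_zero hqs),
    smul_smul, smul_smul, mul_assoc]
  rfl

end FibreIntegralInChart

/-! ### The current in a chart -/

section CurrentInChart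

variable {n : ℕ} {M : Type*} [TopologicalSpace M] [ChartedSpace (EuclideanSpace ℝ (Fin n)) M]
  [IsManifold (𝓡 n) ∞ M]

local notation "𝔼" => EuclideanSpace ℝ (Fin n)

/-- The sign of the coordinates is locally constant. -/
theorem ManifoldOrientation.exists_eventually_sign_eq (o : ManifoldOrientation n M) (p : M) :
    ∃ ε : ℝ, ∀ᶠ q in 𝓝 p, o.sign q * (LinearMap.det (fibreCoord n p q : 𝔼 →ₗ[ℝ] 𝔼) *
      |LinearMap.det (fibreCoord n p q : 𝔼 →ₗ[ℝ] 𝔼)|⁻¹) = ε := by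
  classical
  obtain ⟨w, hw⟩ := o.locally_constant p
  set b := (EuclideanSpace.basisFun (Fin n) ℝ).toBasis.orientation
  have hcard : Fintype.card (Fin n) = Module.finrank ℝ 𝔼 := by simp
  -- The product of signs is the sign of the orientation transported to the chart, which is the
  -- constant w near p.
  refine ⟨if w = b then 1 else -1, ?_⟩
  filter_upwards [hw, extChartAt_source_mem_nhds (I := 𝓡 n) p] with q hq hqs
  have hqb : q ∈ (trivializationAt 𝔼 (TangentSpace (𝓡 n)) p).baseSet := by
    rwa [extChartAt_source] at hqs
  let f : 𝔼 ≃ₗ[ℝ] 𝔼 := (trivializationAt 𝔼 (TangentSpace (𝓡 n)) p).linearEquivAt ℝ q hqb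
  let x : Orientation ℝ 𝔼 (Fin n) := o.orient q
  have hf : (f : 𝔼 →ₗ[ℝ] 𝔼) = (fibreCoord n p q : 𝔼 →ₗ[ℝ] 𝔼) := rfl
  have hx : o.sign q = if x = b then 1 else -1 := rfl
  have h1 : Orientation.map (Fin n) f x = w := hq hqb
  have hne : b ≠ -b := Module.Ray.ne_neg_self b
  rw [hx, ← hf]
  rcases (det_fibreCoord_ne_zero hqs).lt_or_gt with h | h <;> rw [← hf] at h
  · rw [abs_of_neg h, inv_neg, mul_neg, mul_inv_cancel₀ h.ne]
    rw [(Orientation.map_eq_neg_iff_det_neg x f hcard).2 h] at h1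
    rcases (EuclideanSpace.basisFun (Fin n) ℝ).toBasis.orientation_eq_or_eq_neg x with h2 | h2 <;>
      change x = _ at h2
    · rw [if_pos h2, ← h1, h2, if_neg hne.symm, one_mul]
    · have h3 : w = b := by
        rw [← h1, h2]
        exact neg_neg b
      rw [if_neg (h2 ▸ hne.symm), if_pos h3, neg_one_mul, neg_neg]
  · rw [abs_of_pos h, mul_inv_cancel₀ h.ne', mul_one]
    rw [(Orientation.map_eq_iff_det_pos x f hcard).2 h] at h1
    rw [h1]

variable {U : Set (TangentBundle (𝓡 n) M)} {p : M}

theorem DiffForm.inTangentChart_of_mem {k : ℕ}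
    (α : DiffForm (𝓡 n).tangent (TangentBundle (𝓡 n) M) k) {z : 𝔼 × 𝔼}
    (hz : z ∈ chartPreimage p U) :
    α.inTangentChart p U z = α.inChart (⟨p, (0 : 𝔼)⟩ : TangentBundle (𝓡 n) M) z :=
  indicator_of_mem hz _

theorem DiffForm.wedgeOne_inChart {E H N : Type*} [NormedAddCommGroup E] [NormedSpace ℝ E]
    [TopologicalSpace H] {I : ModelWithCorners ℝ E H} [TopologicalSpace N] [ChartedSpace H N]
    {k : ℕ} (χ : DiffForm I N 1) (θ : DiffForm I N k) (x : N) (y : E) :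
    (χ.wedgeOne θ).inChart x y = wedgeOneForm (χ.inChart x y) (θ.inChart x y) :=
  wedgeOneForm_compContinuousLinearMap (V := E) (V' := E) (χ ((extChartAt I x).symm y))
    (θ ((extChartAt I x).symm y)) (mfderiv 𝓘(ℝ, E) I (extChartAt I x).symm y)

/-- A form which vanishes outside a compact set of points of smoothness is smooth. -/
theorem contDiffAt_of_eq_zero_off_compact {X Y F : Type*} [NormedAddCommGroup X] [NormedSpace ℝ X]
    [NormedAddCommGroup Y] [NormedSpace ℝ Y] [NormedAddCommGroup F] [NormedSpace ℝ F]
    {f : X × Y → F} {r : WithTop ℕ∞} {G : Set X} (hG : IsOpen G) {C : Set (X × Y)}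
    (hC : IsCompact C) (hf : ∀ z ∈ C, ContDiffAt ℝ r f z)
    (hf0 : ∀ z : X × Y, z.1 ∈ G → z ∉ C → f z = 0) {z : X × Y} (hz : z.1 ∈ G) :
    ContDiffAt ℝ r f z := by
  by_cases hzC : z ∈ C
  · exact hf z hzC
  · refine contDiffAt_const (c := (0 : F)) |>.congr_of_eventuallyEq ?_
    filter_upwards [(hG.preimage continuous_fst).mem_nhds hz,
      hC.isClosed.isOpen_compl.mem_nhds hzC] with z' h1 h2 using hf0 z' h1 h2

theorem DiffForm.SmoothOn.contDiffAt_wedgeOne_inTangentChart {k : ℕ}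
    {χ : DiffForm (𝓡 n).tangent (TangentBundle (𝓡 n) M) 1}
    {θ : DiffForm (𝓡 n).tangent (TangentBundle (𝓡 n) M) k} (hχ : χ.SmoothOn U) (hθ : θ.SmoothOn U)
    (hU : IsOpen U) {z : 𝔼 × 𝔼} (hz : z ∈ chartPreimage p U) :
    ContDiffAt ℝ ∞ ((χ.wedgeOne θ).inTangentChart p U) z := by
  refine (contDiffAt_wedgeOneForm (hχ.contDiffAt_inChart hz.1 hz.2)
    (hθ.contDiffAt_inChart hz.1 hz.2)).congr_of_eventuallyEq ?_
  filter_upwards [(isOpen_chartPreimage hU).mem_nhds hz] with z' hz'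
  exact ((χ.wedgeOne θ).inTangentChart_of_mem hz').trans (χ.wedgeOne_inChart θ _ z')

theorem finrank_euclidean_eq (hn : 1 ≤ n) : Module.finrank ℝ 𝔼 = n - 1 + 1 := by
  rw [finrank_euclideanSpace_fin]
  omega

/-- Near a point, the current is a multiple of a fibre integral in the chart. -/
theorem exists_current_inChart_eventuallyEq (hn : 1 ≤ n) (o : ManifoldOrientation n M)
    (hU : IsOpen U) (χ : DiffForm (𝓡 n).tangent (TangentBundle (𝓡 n) M) 1)
    (θ : DiffForm (𝓡 n).tangent (TangentBundle (𝓡 n) M) (2 * n - 2)) (p : M) :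
    ∃ ε : ℝ, ∀ᶠ x in 𝓝 (extChartAt (𝓡 n) p p), (current hn o U χ θ).inChart p x =
      ε • prodFibreIntegral (by omega) (EuclideanSpace.basisFun (Fin n) ℝ).toBasis volume
        ((χ.wedgeOne θ).inTangentChart p U) x := by
  obtain ⟨ε, hε⟩ := o.exists_eventually_sign_eq p
  refine ⟨ε, ?_⟩
  have h1 : Tendsto (extChartAt (𝓡 n) p).symm (𝓝 (extChartAt (𝓡 n) p p)) (𝓝 p) := by
    have := continuousAt_extChartAt_symm (I := 𝓡 n) p
    rwa [ContinuousAt, extChartAt_to_inv] at this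
  filter_upwards [h1.eventually hε, (isOpen_extChartAt_target (I := 𝓡 n) p).mem_nhds
    (mem_extChartAt_target p)] with x hx hxt
  rw [current, fibreIntegral_inChart o hU _ _ hxt, hx]

/-- In the chart, the current is closed wherever the support of `χ ∧ θ` is locally proper over the
base. -/
theorem extDeriv_prodFibreIntegral_inTangentChart_eq_zero (hn : 1 ≤ n) (hU : IsConicSubbundle U)
    {Ψ : BivectorField (𝓡 n).tangent (TangentBundle (𝓡 n) M)} (hΨ : IsVlasovBivector U Ψ)
    {θ : DiffForm (𝓡 n).tangent (TangentBundle (𝓡 n) M) (2 * n - 2)}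
    (hθ : TransportEquations U Ψ θ)
    {χ : DiffForm (𝓡 n).tangent (TangentBundle (𝓡 n) M) 1} (hχ : IsSupportForm U χ)
    (hq : 2 * n - 2 + 1 = n - 1 + n) {G : Set 𝔼} (hG : IsOpen G) {C : Set (𝔼 × 𝔼)}
    (hC : IsCompact C) (hCU : C ⊆ chartPreimage p U)
    (h0 : ∀ z : 𝔼 × 𝔼, z.1 ∈ G → z ∉ C → (χ.wedgeOne θ).inTangentChart p U z = 0) {x : 𝔼}
    (hx : x ∈ G) :
    extDeriv (prodFibreIntegral hq (EuclideanSpace.basisFun (Fin n) ℝ).toBasis volume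
      ((χ.wedgeOne θ).inTangentChart p U)) x = 0 := by
  have h1 : (1 : WithTop ℕ∞) ≤ ∞ := by simp
  have hs : ∀ z ∈ chartPreimage p U, ContDiffAt ℝ ∞ ((χ.wedgeOne θ).inTangentChart p U) z :=
    fun z hz => hχ.smooth.contDiffAt_wedgeOne_inTangentChart hθ.smooth hU.isOpen hz
  exact extDeriv_prodFibreIntegral_eq_zero volume hn hq (finrank_euclidean_eq hn) _
    (isOpen_chartPreimage hU.isOpen) (fun z hz t => radialFlow_mem_chartPreimage hU hz t)
    (fun z hz => snd_ne_zero_of_mem_chartPreimage hU hz)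
    (fun z hz => (hθ.smooth.contDiffAt_inChart hz.1 hz.2).of_le h1)
    (fun z hz => hθ.smooth.extDeriv_inChart_eq_zero hz.1 hz.2 (hθ.closed _ hz.2))
    (fun z hz v hv => inChart_apply_eq_zero_of_null hΨ hθ.null hz v hv)
    (fun z hz => integral_radialFlow_eq_one hχ hz)
    (fun z hz => ((χ.wedgeOne θ).inTangentChart_of_mem hz).trans (χ.wedgeOne_inChart θ _ z))
    hG hC hCU h0
    (fun z hz => contDiffAt_of_eq_zero_off_compact hG hC (fun z hz => (hs z (hCU hz)).of_le h1)
      h0 hz) hx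

theorem inTangentChart_eq_zero_of_eq_zero {k : ℕ}
    (α : DiffForm (𝓡 n).tangent (TangentBundle (𝓡 n) M) k) {z : 𝔼 × 𝔼}
    (hz : α ((tangentChart n p).symm z) = 0) : α.inTangentChart p U z = 0 := by
  by_cases h : z ∈ chartPreimage p U
  · rw [α.inTangentChart_of_mem h, DiffForm.inChart]
    have h1 : ∀ (A : (𝔼 × 𝔼) [⋀^Fin k]→L[ℝ] ℝ) (D : 𝔼 × 𝔼 →L[ℝ] 𝔼 × 𝔼), A = 0 →
        A.compContinuousLinearMap D = 0 := by
      rintro A D rfl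
      rfl
    exact h1 _ _ hz
  · exact indicator_of_notMem h _

end CurrentInChart

/-! ### Local properness of the support, and charge conservation -/

section Conservation

variable {n : ℕ} {M : Type*} [TopologicalSpace M] [ChartedSpace (EuclideanSpace ℝ (Fin n)) M]
  [IsManifold (𝓡 n) ∞ M] {U : Set (TangentBundle (𝓡 n) M)} {p : M}

local notation "𝔼" => EuclideanSpace ℝ (Fin n)

/-- If the support of `α` is proper over the base, then so is its support in the chart, locally. -/
theorem HasProperVerticalSupport.exists_compact [T2Space M] {k : ℕ}
    {α : DiffForm (𝓡 n).tangent (TangentBundle (𝓡 n) M) k} (hα : HasProperVerticalSupport U α)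
    (p : M) : ∃ G : Set 𝔼, IsOpen G ∧ extChartAt (𝓡 n) p p ∈ G ∧ ∃ C ⊆ chartPreimage p U,
      IsCompact C ∧ ∀ z : 𝔼 × 𝔼, z.1 ∈ G → z ∉ C → α.inTangentChart p U z = 0 := by
  obtain ⟨r, hr, hrt⟩ := Metric.nhds_basis_closedBall.mem_iff.1
    ((isOpen_extChartAt_target (I := 𝓡 n) p).mem_nhds (mem_extChartAt_target p))
  have hK : IsCompact ((extChartAt (𝓡 n) p).symm '' Metric.closedBall (extChartAt (𝓡 n) p p) r) :=
    (isCompact_closedBall _ _).image_of_continuousOn ((continuousOn_extChartAt_symm p).mono hrt)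
  obtain ⟨C, hCU, hC, hC0⟩ := hα _ hK
  have hproj : Continuous (fun u : TangentBundle (𝓡 n) M => u.proj) :=
    FiberBundle.continuous_proj 𝔼 (TangentSpace (𝓡 n))
  set K := (extChartAt (𝓡 n) p).symm '' Metric.closedBall (extChartAt (𝓡 n) p p) r with hKdef
  have hsub : C ∩ TotalSpace.proj ⁻¹' K ⊆ (tangentChart n p).source := by
    rintro u ⟨-, y, hy, hyu⟩
    rw [mem_tangentChart_source, ← hyu]
    exact (extChartAt (𝓡 n) p).map_target (hrt hy)
  refine ⟨Metric.ball (extChartAt (𝓡 n) p p) r, Metric.isOpen_ball, Metric.mem_ball_self hr,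
    tangentChart n p '' (C ∩ TotalSpace.proj ⁻¹' K), ?_, ?_, ?_⟩
  · rintro _ ⟨u, hu, rfl⟩
    refine ⟨(tangentChart n p).map_source (hsub hu), ?_⟩
    rw [mem_preimage, (tangentChart n p).left_inv (hsub hu)]
    exact hCU hu.1
  -- Hausdorffness of M makes the compact K closed, so cutting C down to the part over K keeps it
  -- compact.
  · exact (hC.inter_right (hK.isClosed.preimage hproj)).image_of_continuousOn
      ((continuousOn_extChartAt _).mono hsub)
  · intro z hz hzC
    by_cases hzU : z ∈ chartPreimage p U
    · have hzK : ((tangentChart n p).symm z).proj ∈ K :=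
        ⟨z.1, Metric.ball_subset_closedBall hz, rfl⟩
      exact inTangentChart_eq_zero_of_eq_zero α (hC0 _ hzU.2 hzK fun h =>
        hzC ⟨_, ⟨h, hzK⟩, (tangentChart n p).right_inv hzU.1⟩)
    · exact indicator_of_notMem hzU _

/-- If the support of `α` in each fibre is compact, then the support of `α` is locally proper over a
dense set of points of the base. -/
theorem HasVerticalCompactSupport.dense_exists_compact {k : ℕ}
    {α : DiffForm (𝓡 n).tangent (TangentBundle (𝓡 n) M) k} (hα : HasVerticalCompactSupport U α)
    (hU : IsOpen U) (hc : ContinuousOn (α.inTangentChart p U) (chartPreimage p U)) :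
    Dense {x : 𝔼 | ∃ G : Set 𝔼, IsOpen G ∧ x ∈ G ∧ ∃ C ⊆ chartPreimage p U,
      IsCompact C ∧ ∀ z : 𝔼 × 𝔼, z.1 ∈ G → z ∉ C → α.inTangentChart p U z = 0} := by
  have hO := isOpen_chartPreimage (p := p) hU
  have : LocallyCompactSpace (chartPreimage p U) := hO.locallyCompactSpace
  let e : CompactExhaustion (chartPreimage p U) := default
  let C : ℕ → Set (𝔼 × 𝔼) := fun m => Subtype.val '' e m
  have hC : ∀ m, IsCompact (C m) := fun m => (e.isCompact m).image continuous_subtype_val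
  have hCO : ∀ m, C m ⊆ chartPreimage p U := fun m => by
    rintro _ ⟨z, -, rfl⟩
    exact z.2
  -- Base points over which the fibre support lies in the m-th compact set of an exhaustion of the
  -- chart domain of U.
  let f : ℕ → Set 𝔼 := fun m => {x | ∀ y : 𝔼, (x, y) ∈ chartPreimage p U → (x, y) ∉ C m →
    α.inTangentChart p U (x, y) = 0}
  have hf : ∀ m, IsClosed (f m) := by
    intro m
    have h1 : IsOpen ((chartPreimage p U ∩ (α.inTangentChart p U) ⁻¹' {0}ᶜ) ∩ (C m)ᶜ) :=
      (hc.isOpen_inter_preimage hO isOpen_compl_singleton).inter (hC m).isClosed.isOpen_compl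
    have h2 : f m = ⋂ y : 𝔼, ((fun x : 𝔼 => (x, y)) ⁻¹'
        ((chartPreimage p U ∩ (α.inTangentChart p U) ⁻¹' {0}ᶜ) ∩ (C m)ᶜ))ᶜ := by
      ext x
      simp only [f, mem_ofPred_eq, mem_iInter, mem_compl_iff, mem_preimage, mem_inter_iff,
        mem_singleton_iff]
      exact forall_congr' fun y => by tauto
    rw [h2]
    exact isClosed_iInter fun y => (h1.preimage (by fun_prop)).isClosed_compl
  -- Each fibre support lies in a compact subset of the chart domain, hence in some member of the
  -- exhaustion; outside the chart target the fibre is empty and m = 0 works.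
  have hcov : ⋃ m, f m = univ := by
    refine eq_univ_of_forall fun x => mem_iUnion.2 ?_
    by_cases hx : x ∈ (extChartAt (𝓡 n) p).target
    · obtain ⟨K, hK, hKU, hK0⟩ := hα ((extChartAt (𝓡 n) p).symm x)
      have hqs := (extChartAt (𝓡 n) p).map_target hx
      have hxs := (extChartAt (𝓡 n) p).right_inv hx
      set q := (extChartAt (𝓡 n) p).symm x
      have hK' : IsCompact ((fun y => (x, fibreCoord n p q y)) '' K) := hK.image (by fun_prop)
      have hK'O : (fun y => (x, fibreCoord n p q y)) '' K ⊆ chartPreimage p U := by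
        rintro _ ⟨y, hy, rfl⟩
        have := (mem_chartPreimage_iff hqs y).2 (hKU y hy)
        rwa [hxs] at this
      obtain ⟨m, hm⟩ := e.exists_superset_of_isCompact
        (Topology.IsInducing.subtypeVal.isCompact_preimage_iff (f := (Subtype.val :
          chartPreimage p U → 𝔼 × 𝔼)) (by simpa using hK'O) |>.2 hK')
      refine ⟨m, fun y hy hyC => ?_⟩
      obtain ⟨y, rfl⟩ : ∃ y', fibreCoord n p q y' = y := ⟨_, fibreCoord_apply_symm hqs y⟩
      have h1 := tangentChart_symm_fibreCoord hqs y
      have h2 := mem_chartPreimage_iff (U := U) hqs y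
      rw [hxs] at h1 h2
      refine inTangentChart_eq_zero_of_eq_zero α ?_
      rw [h1]
      exact hK0 y (h2.1 hy) fun hyK => hyC ⟨⟨_, hy⟩, hm ⟨y, hyK, rfl⟩, rfl⟩
    · exact ⟨0, fun y hy _ => absurd (fst_mem_of_mem_chartPreimage hy) hx⟩
  -- Baire: countably many closed sets cover the space, so the union of their interiors is dense; on
  -- each interior one compact set serves all fibres.
  refine (dense_iUnion_interior_of_closed hf hcov).mono ?_
  refine iUnion_subset fun m x hx => ⟨interior (f m), isOpen_interior, hx, C m, hCO m, hC m, ?_⟩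
  intro z hz hzC
  by_cases hzU : z ∈ chartPreimage p U
  · exact interior_subset hz z.2 hzU hzC
  · exact indicator_of_notMem hzU _

theorem smoothOn_current [T2Space M] (hn : 1 ≤ n) (o : ManifoldOrientation n M) (hU : IsOpen U)
    {χ : DiffForm (𝓡 n).tangent (TangentBundle (𝓡 n) M) 1}
    {θ : DiffForm (𝓡 n).tangent (TangentBundle (𝓡 n) M) (2 * n - 2)} (hχ : χ.SmoothOn U)
    (hθ : θ.SmoothOn U) (hc : HasProperVerticalSupport U (χ.wedgeOne θ)) :
    (current hn o U χ θ).SmoothOn univ := by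
  intro p _
  obtain ⟨ε, hε⟩ := exists_current_inChart_eventuallyEq hn o hU χ θ p
  obtain ⟨G, hG, hpG, C, hCU, hC, h0⟩ := hc.exists_compact p
  have hs : ContDiffOn ℝ ∞ (prodFibreIntegral (show 2 * n - 2 + 1 = n - 1 + n by omega)
      (EuclideanSpace.basisFun (Fin n) ℝ).toBasis volume ((χ.wedgeOne θ).inTangentChart p U)) G :=
    contDiffOn_prodFibreIntegral volume _ _ (r := ⊤) hG hC h0 fun z hz =>
      contDiffAt_of_eq_zero_off_compact hG hC
        (fun z hz => hχ.contDiffAt_wedgeOne_inTangentChart hθ hU (hCU hz)) h0 hz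
  exact ((hs.contDiffAt (hG.mem_nhds hpG)).const_smul ε).congr_of_eventuallyEq hε

/-- The local argument gives dJ = 0 only over the dense set where the support is locally proper.
Smoothness of J makes its exterior derivative continuous in the chart, so a non-zero value at p
would persist at nearby points of that set. -/
theorem current_closed (hn : 1 ≤ n) (o : ManifoldOrientation n M) (hU : IsConicSubbundle U)
    {Ψ : BivectorField (𝓡 n).tangent (TangentBundle (𝓡 n) M)} (hΨ : IsVlasovBivector U Ψ)
    {θ : DiffForm (𝓡 n).tangent (TangentBundle (𝓡 n) M) (2 * n - 2)}
    (hθ : TransportEquations U Ψ θ)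
    {χ : DiffForm (𝓡 n).tangent (TangentBundle (𝓡 n) M) 1} (hχ : IsSupportForm U χ)
    (hc : HasVerticalCompactSupport U (χ.wedgeOne θ)) (hJ : (current hn o U χ θ).SmoothOn univ)
    (p : M) : (current hn o U χ θ).d p = 0 := by
  have hq : 2 * n - 2 + 1 = n - 1 + n := by omega
  have hα : ∀ z ∈ chartPreimage p U, ContDiffAt ℝ ∞ ((χ.wedgeOne θ).inTangentChart p U) z :=
    fun z hz => hχ.smooth.contDiffAt_wedgeOne_inTangentChart hθ.smooth hU.isOpen hz
  obtain ⟨ε, hε⟩ := exists_current_inChart_eventuallyEq hn o hU.isOpen χ θ p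
  have hdense := hc.dense_exists_compact (p := p) hU.isOpen
    fun z hz => (hα z hz).continuousAt.continuousWithinAt
  set f := (current hn o U χ θ).inChart p with hf
  have hcont : ContinuousAt (extDeriv f) (extChartAt (𝓡 n) p p) := by
    have h1 : ContDiffOn ℝ 1 f (extChartAt (𝓡 n) p).target := fun y hy =>
      ((hJ.contDiffAt_inChart hy (mem_univ _)).of_le (by simp)).contDiffWithinAt
    exact (continuousOn_extDeriv (isOpen_extChartAt_target p) h1).continuousAt
      ((isOpen_extChartAt_target p).mem_nhds (mem_extChartAt_target p))
  have hzero : extDeriv f (extChartAt (𝓡 n) p p) = 0 := by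
    by_contra hne
    obtain ⟨x, hx, hxne, hxε⟩ := mem_closure_iff_frequently.1 (hdense (extChartAt (𝓡 n) p p))
      |>.and_eventually ((hcont.eventually_ne hne).and hε.eventually_nhds) |>.exists
    obtain ⟨G, hG, hxG, C, hCU, hC, h0⟩ := hx
    apply hxne
    have h2 : extDeriv f x = extDeriv (ε • prodFibreIntegral hq
        (EuclideanSpace.basisFun (Fin n) ℝ).toBasis volume
        ((χ.wedgeOne θ).inTangentChart p U)) x := Filter.EventuallyEq.extDeriv_eq hxε
    have h3 := extDeriv_prodFibreIntegral_inTangentChart_eq_zero hn hU hΨ hθ hχ hq hG hC hCU h0 hxG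
    have hs := (contDiffOn_prodFibreIntegral volume hq
      (EuclideanSpace.basisFun (Fin n) ℝ).toBasis (r := ⊤) hG hC h0 fun z hz =>
        contDiffAt_of_eq_zero_off_compact hG hC (fun z hz => hα z (hCU hz)) h0 hz).contDiffAt
          (hG.mem_nhds hxG)
    rw [h2, extDeriv_smul, h3, smul_zero]
  rw [DiffForm.d, ← hf, hzero]
  rfl

end Conservation

end

theorem mainTheorem9 {n : ℕ} (hn : 1 ≤ n)
    {M : Type*} [TopologicalSpace M] [T2Space M] [SecondCountableTopology M] [ConnectedSpace M]
    [ChartedSpace (EuclideanSpace ℝ (Fin n)) M] [IsManifold (𝓡 n) ∞ M]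
    (o : ManifoldOrientation n M)
    (U : Set (TangentBundle (𝓡 n) M)) (hU : IsConicSubbundle U)
    (Ψ : BivectorField (𝓡 n).tangent (TangentBundle (𝓡 n) M)) (hΨ : IsVlasovBivector U Ψ)
    (θ : DiffForm (𝓡 n).tangent (TangentBundle (𝓡 n) M) (2 * n - 2))
    (hθ : TransportEquations U Ψ θ)
    (χ : DiffForm (𝓡 n).tangent (TangentBundle (𝓡 n) M) 1) (hχ : IsSupportForm U χ)
    (hc : HasVerticalCompactSupport U (χ.wedgeOne θ)) :
    (HasProperVerticalSupport U (χ.wedgeOne θ) → (current hn o U χ θ).SmoothOn univ) ∧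
    ((current hn o U χ θ).SmoothOn univ → ∀ p : M, (current hn o U χ θ).d p = 0) :=
  ⟨smoothOn_current hn o hU.isOpen hχ.smooth hθ.smooth,
    fun hJ p => current_closed hn o hU hΨ hθ hχ hc hJ p⟩
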